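/- Let $\mathcal{L\text{-}P}$ be the Laguerre–Pólya class, i.e. the set of functions $$f(z)=cz^d e^{-\gamma z^2+\beta z}\prod_{j=1}^{\omega}\Bigl(1-\frac{z}{\alpha_j}\Bigr)e^{z/\alpha_j},\qquad 0\le\omega\le\infty,$$ with $c,\beta\in\mathbb R$, $\alpha_j\in\mathbb R\setminus\{0\}$, $\gamma\ge 0$, $d\in\mathbb Z_{\ge 0}$ and $\sum_j\alpha_j^{-2}<\infty$. Let $\mathcal{L\text{-}P^*}$ be the set of products $pf$, where $f\in\mathcal{L\text{-}P}$ and $p$ is a real polynomial with no real zeros. For an entire function $\varphi\not\equiv0$ put $Q[\varphi]=(\varphi'/\varphi)'$, a meromorphic function, and let $Z_{\mathbb C}(\varphi)$ be the number of nonreal zeros of $\varphi$, counted with multiplicity. Let $\alpha$ be a real zero of $\varphi$. Let $\beta_1<\alpha$ be the largest real zero of $\varphi'$ in $(-\infty,\alpha)$; if $\alpha$ is the smallest real zero of $\varphi$ and $\varphi'$ has no zero in $(-\infty,\alpha)$, let $\beta_1=-\infty$. Let $\beta_2>\alpha$ be the smallest real zero of $\varphi'$ in $(\alpha,\infty)$;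 if $\alpha$ is the largest real zero of $\varphi$ and $\varphi'$ has no zero in $(\alpha,\infty)$, let $\beta_2=+\infty$. The function $\varphi$ has property A at $\alpha$ if $Q[\varphi]$ has no zeros in at least one of the intervals $(\beta_1,\alpha)$ and $(\alpha,\beta_2)$. It has property A if it has property A at each of its real zeros (in particular, if it has no real zeros). **Theorem.** Let $\varphi\in\mathcal{L\text{-}P^*}$, and suppose that $\varphi$ is not of the form $Ce^{\beta z}$ with $C,\beta\in\mathbb R$. Then there is a real number $\sigma_*$ such that $\psi_*(z)=e^{-\sigma_* z}\varphi(z)$ belongs to $\mathcal{L\text{-}P^*}$, has property A, has the same zeros as $\varphi$ with the same multiplicities, and satisfies $Q[\psi_*]=Q[\varphi]$. Moreover, $\sigma_*$ can be chosen so that, in addition, if $Q[\varphi]$ has at least one real zero, then $Z_{\mathbb C}(\psi_*')<Z_{\mathbb C}(\psi_*)$. -/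

import Mathlib

open Complex

noncomputable section

/-- The Laguerre–Pólya class: functions
`c z^d e^{-γ z² + β z} ∏_{j < ω} (1 - z/α_j) e^{z/α_j}` with `0 ≤ ω ≤ ∞`, real `c, β, α_j`
(`α_j ≠ 0`), `γ ≥ 0`, `d ∈ ℕ` and `∑ α_j⁻² < ∞`. -/
def LaguerrePolya (φ : ℂ → ℂ) : Prop :=
  ∃ (c β γ : ℝ) (d : ℕ) (ω : ℕ∞) (α : {j : ℕ // (j : ℕ∞) < ω} → ℝ),
    0 ≤ γ ∧ (∀ j, α j ≠ 0) ∧ Summable (fun j => ((α j) ^ 2)⁻¹) ∧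
    ∀ z : ℂ, ∃ P : ℂ,
      HasProd (fun j => (1 - z / (α j : ℂ)) * Complex.exp (z / (α j : ℂ))) P ∧
      φ z = (c : ℂ) * z ^ d * Complex.exp (-(γ : ℂ) * z ^ 2 + (β : ℂ) * z) * P

/-- The class `L-P*`: products of a real polynomial without real zeros and a function of the
Laguerre–Pólya class. -/
def LaguerrePolyaStar (φ : ℂ → ℂ) : Prop :=
  ∃ (p : Polynomial ℝ) (f : ℂ → ℂ), (∀ x : ℝ, p.eval x ≠ 0) ∧ LaguerrePolya f ∧
    ∀ z : ℂ, φ z = Polynomial.aeval z p * f z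

/-- `Q[φ] = (φ'/φ)'`. This function is meromorphic when `φ` is entire; its zeros below are always
taken in the sense of meromorphic functions, so the values Lean assigns at its poles play no
role in them. -/
def logDerivDeriv (φ : ℂ → ℂ) : ℂ → ℂ := deriv (fun z => deriv φ z / φ z)

/-- The meromorphic function `f` has a zero at `z`. -/
def HasZeroAt (f : ℂ → ℂ) (z : ℂ) : Prop := 0 < meromorphicOrderAt f z

/-- The multiplicity of `z` as a zero of the meromorphic function `f`; it is `0` at poles and
wherever `f` does not vanish. -/
def zeroMultiplicity (f : ℂ → ℂ) (z : ℂ) : ℕ∞ := WithTop.map Int.toNat (meromorphicOrderAt f z)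

/-- `Z_X(f)`: the number of zeros of `f` on `X`, counting multiplicities, in `{0, 1, …, ∞}`. -/
def zeroCount (X : Set ℂ) (f : ℂ → ℂ) : ℕ∞ :=
  ⨆ (s : Finset ℂ) (_ : (s : Set ℂ) ⊆ X), ∑ z ∈ s, zeroMultiplicity f z

/-- `Z_ℂ(f)`: the number of nonreal zeros of `f`, counting multiplicities. -/
def nonrealZeroCount (f : ℂ → ℂ) : ℕ∞ := zeroCount {z : ℂ | z.im ≠ 0} f

/-- `Z_ℝ(f)`: the number of real zeros of `f`, counting multiplicities. -/
def realZeroCount (f : ℂ → ℂ) : ℕ∞ := zeroCount {z : ℂ | z.im = 0} f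

/-- `φ` has property A at its real zero `α`. Here `β₁` is the real zero of `φ'` next to `α` on
the left; `β₁ = -∞` if `α` is the smallest real zero of `φ` and `φ'` has no zero to the left
of `α`. Similarly for `β₂` on the right. -/
def PropertyAAt (φ : ℂ → ℂ) (α : ℝ) : Prop :=
  ∀ β₁ β₂ : EReal, β₁ < (α : EReal) → (α : EReal) < β₂ →
    ((∃ b : ℝ, β₁ = (b : EReal) ∧ deriv φ (b : ℂ) = 0) ∨
      (β₁ = ⊥ ∧ IsLeast {x : ℝ | φ (x : ℂ) = 0} α)) →
    ((∃ b : ℝ, β₂ = (b : EReal) ∧ deriv φ (b : ℂ) = 0) ∨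
      (β₂ = ⊤ ∧ IsGreatest {x : ℝ | φ (x : ℂ) = 0} α)) →
    (∀ x : ℝ, β₁ < (x : EReal) → (x : EReal) < β₂ → x ≠ α → deriv φ (x : ℂ) ≠ 0) →
    (∀ x : ℝ, β₁ < (x : EReal) → x < α → ¬ HasZeroAt (logDerivDeriv φ) (x : ℂ)) ∨
    (∀ x : ℝ, α < x → (x : EReal) < β₂ → ¬ HasZeroAt (logDerivDeriv φ) (x : ℂ))

/-- `φ` has property A: it has property A at each of its real zeros. -/
def PropertyA (φ : ℂ → ℂ) : Prop :=
  ∀ α : ℝ, φ (α : ℂ) = 0 → PropertyAAt φ α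

/-- The function `z ↦ e^{-σ z} φ(z)`. -/
def expTwist (σ : ℝ) (φ : ℂ → ℂ) : ℂ → ℂ := fun z => Complex.exp (-(σ : ℂ) * z) * φ z

end

/-! Put L = φ'/φ. Passing from φ to e^{-σz}φ replaces L by L - σ and leaves Q = L' unchanged, so
only σ has to be chosen. On the real axis, off the zeros ζᵢ of φ, Q(x) = -(2γ + ∑ (ζᵢ - x)⁻²), which
is negative for large |x| because only finitely many ζᵢ are nonreal. Hence L has finitely many real
critical points (`finite_real_critical`), and σ is the largest critical value.

Property A: L - σ is nonpositive at every real critical point, but positive from a real zero of φ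
rightwards up to the next zero of φ' (`re_logDeriv_pos`). So Q has no zero in (α, β₂).

Loss of nonreal zeros: if Q has a real zero, L - σ has a multiple real zero x. Write φ for the
twisted function and let it have m distinct zeros in the upper half-plane. The core
(`length_ne_card`) is that φ' cannot have m zeros there, with multiplicity, outside the zeros of φ.
Otherwise let W consist of x and m such zeros. The 2m + 2 points of W and its conjugate are critical
points with multiplicity, and comparing partial fractions gives ∑ g(ζᵢ) / ∏ (ζᵢ - t) = -2γ g_{2m}
for every polynomial g of degree at most 2m (`hasSum_eval_mul_prod_inv`). Linear algebra gives q ≠ 0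
of degree at most m such that R = q / ∏_{t ∈ W} (z - t) agrees at each zero of φ and at its
conjugate. With g = q q*, where q* has the conjugate coefficients, the identity reads ∑ |R(ζᵢ)|² =
-2γ |q_m|². So q vanishes at all zeros of φ, which forces m = 0, no zeros and γ = 0, the excluded
exponential case.

Finally, each distinct nonreal zero of φ costs φ' one multiplicity, at least 2m in all, while new
nonreal zeros contribute at most 2(m - 1). -/

open scoped Topology ComplexConjugate

/-! ### Partial fractions of the logarithmic derivative -/

/-- `φ` is an entire function with zeros `ζ i` (repeated according to multiplicity) whose
logarithmic derivative is `-2γz + const + ∑ᵢ 1 / (z - ζ i)`, suitably regularised. -/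
structure LogDerivExpansion (φ : ℂ → ℂ) {ι : Type} (ζ : ι → ℂ) (γ : ℝ) : Prop where
  differentiable : Differentiable ℂ φ
  gamma_nonneg : 0 ≤ γ
  zero_iff : ∀ z, φ z = 0 ↔ ∃ i, ζ i = z
  summable : ∀ z, φ z ≠ 0 → Summable fun i => (‖ζ i - z‖ ^ 2)⁻¹
  logDeriv_sub : ∀ z t, φ z ≠ 0 → φ t ≠ 0 →
    logDeriv φ z - logDeriv φ t = -(z - t) * (2 * γ + ∑' i, (ζ i - z)⁻¹ * (ζ i - t)⁻¹)

namespace LogDerivExpansion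

variable {φ : ℂ → ℂ} {ι : Type} {ζ : ι → ℂ} {γ : ℝ}

lemma zeros_ne (h : LogDerivExpansion φ ζ γ) {z : ℂ} (hz : φ z ≠ 0) (i : ι) : ζ i - z ≠ 0 :=
  fun hi => hz ((h.zero_iff z).2 ⟨i, sub_eq_zero.1 hi⟩)

lemma exists_pos_le_norm_sub (h : LogDerivExpansion φ ζ γ) {z : ℂ} (hz : φ z ≠ 0) :
    ∃ r > 0, ∀ i, r ≤ ‖ζ i - z‖ := by
  have h1 : ∀ᶠ w in 𝓝 z, φ w ≠ 0 := h.differentiable.continuous.continuousAt.eventually_ne hz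
  obtain ⟨r, hr, hb⟩ := Metric.eventually_nhds_iff.1 h1
  refine ⟨r, hr, fun i => not_lt.1 fun hi => ?_⟩
  exact hb (y := ζ i) (by rwa [dist_eq_norm]) ((h.zero_iff _).2 ⟨i, rfl⟩)

lemma exists_norm_inv_le (h : LogDerivExpansion φ ζ γ) {z : ℂ} (hz : φ z ≠ 0) :
    ∃ C, 0 ≤ C ∧ ∀ i, ‖(ζ i - z)⁻¹‖ ≤ C := by
  obtain ⟨r, hr, hb⟩ := h.exists_pos_le_norm_sub hz
  refine ⟨r⁻¹, by positivity, fun i => ?_⟩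
  rw [norm_inv]
  exact inv_anti₀ hr (hb i)

lemma exists_norm_prod_inv_le (h : LogDerivExpansion φ ζ γ) (T : List ℂ) (hT : ∀ t ∈ T, φ t ≠ 0) :
    ∃ C, 0 ≤ C ∧ ∀ i, ‖(T.map fun t => (ζ i - t)⁻¹).prod‖ ≤ C := by
  induction T with
  | nil => exact ⟨1, zero_le_one, fun i => by simp⟩
  | cons t T ih =>
    obtain ⟨C, hC, hb⟩ := ih fun s hs => hT s (List.mem_cons_of_mem _ hs)
    obtain ⟨D, hD, hb'⟩ := h.exists_norm_inv_le (hT t List.mem_cons_self)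
    refine ⟨D * C, by positivity, fun i => ?_⟩
    rw [List.map_cons, List.prod_cons, norm_mul]
    exact mul_le_mul (hb' i) (hb i) (norm_nonneg _) hD

lemma summable_norm_inv_mul_inv (h : LogDerivExpansion φ ζ γ) {z t : ℂ} (hz : φ z ≠ 0)
    (ht : φ t ≠ 0) : Summable fun i => ‖(ζ i - z)⁻¹‖ * ‖(ζ i - t)⁻¹‖ := by
  refine Summable.of_nonneg_of_le (fun i => by positivity) (fun i => ?_)
    ((h.summable z hz).add (h.summable t ht))
  have h1 := two_mul_le_add_sq ‖(ζ i - z)⁻¹‖ ‖(ζ i - t)⁻¹‖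
  have h2 : 0 ≤ ‖(ζ i - z)⁻¹‖ * ‖(ζ i - t)⁻¹‖ := by positivity
  rw [← inv_pow, ← inv_pow, ← norm_inv, ← norm_inv]
  linarith

lemma summable_norm_inv_mul_prod (h : LogDerivExpansion φ ζ γ) {z : ℂ} (hz : φ z ≠ 0)
    {T : List ℂ} (hT : ∀ t ∈ T, φ t ≠ 0) (hT' : T ≠ []) :
    Summable fun i => ‖(ζ i - z)⁻¹‖ * ‖(T.map fun t => (ζ i - t)⁻¹).prod‖ := by
  obtain ⟨t, T, rfl⟩ := List.exists_cons_of_ne_nil hT'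
  obtain ⟨C, hC, hb⟩ := h.exists_norm_prod_inv_le T fun s hs => hT s (List.mem_cons_of_mem _ hs)
  refine Summable.of_nonneg_of_le (fun i => by positivity) (fun i => ?_)
    ((h.summable_norm_inv_mul_inv hz (hT t List.mem_cons_self)).mul_right C)
  rw [List.map_cons, List.prod_cons, norm_mul, ← mul_assoc]
  exact mul_le_mul_of_nonneg_left (hb i) (by positivity)

end LogDerivExpansion

/-- The sum `∑ᵢ 1 / ((ζ i - z) ∏_{t ∈ T} (ζ i - t))`. -/
noncomputable def sumInvProd {ι : Type} (ζ : ι → ℂ) (T : List ℂ) (z : ℂ) : ℂ :=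
  ∑' i, (ζ i - z)⁻¹ * (T.map fun t => (ζ i - t)⁻¹).prod

namespace LogDerivExpansion

variable {φ : ℂ → ℂ} {ι : Type} {ζ : ι → ℂ} {γ : ℝ}

lemma summable_inv_mul_prod (h : LogDerivExpansion φ ζ γ) {z : ℂ} (hz : φ z ≠ 0)
    {T : List ℂ} (hT : ∀ t ∈ T, φ t ≠ 0) (hT' : T ≠ []) :
    Summable fun i => (ζ i - z)⁻¹ * (T.map fun t => (ζ i - t)⁻¹).prod := by
  refine Summable.of_norm ?_
  simpa only [norm_mul] using h.summable_norm_inv_mul_prod hz hT hT'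

/-- Near `z` the distance to each zero shrinks at most by half, so twice the norm of the term at `z`
is a summable majorant. A nonempty `T` is needed: `∑ 1 / (ζ i - z)` alone may diverge. -/
lemma continuousAt_sumInvProd (h : LogDerivExpansion φ ζ γ) {z : ℂ} (hz : φ z ≠ 0)
    {T : List ℂ} (hT : ∀ t ∈ T, φ t ≠ 0) (hT' : T ≠ []) :
    ContinuousAt (sumInvProd ζ T) z := by
  obtain ⟨r, hr, hb⟩ := h.exists_pos_le_norm_sub hz
  have key : ∀ i, ∀ w ∈ Metric.ball z (r / 2), ‖ζ i - z‖ / 2 ≤ ‖ζ i - w‖ := by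
    intro i w hw
    rw [Metric.mem_ball, dist_eq_norm] at hw
    have h1 : ‖ζ i - z‖ ≤ ‖ζ i - w‖ + ‖w - z‖ := by
      simpa using norm_add_le (ζ i - w) (w - z)
    have := hb i
    linarith
  have hc : ContinuousOn (sumInvProd ζ T) (Metric.ball z (r / 2)) := by
    refine continuousOn_tsum (u := fun i => 2 * (‖(ζ i - z)⁻¹‖ *
      ‖(T.map fun t => (ζ i - t)⁻¹).prod‖)) (fun i => ?_)
      ((h.summable_norm_inv_mul_prod hz hT hT').mul_left 2) (fun i w hw => ?_)
    · refine ContinuousOn.mul (ContinuousOn.inv₀ (by fun_prop) fun w hw h0 => ?_)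
        continuousOn_const
      have := key i w hw
      rw [h0, norm_zero] at this
      have := hb i
      linarith
    · rw [norm_mul, ← mul_assoc]
      refine mul_le_mul_of_nonneg_right ?_ (norm_nonneg _)
      have h1 := key i w hw
      have h2 := hb i
      rw [norm_inv, norm_inv]
      calc ‖ζ i - w‖⁻¹ ≤ (‖ζ i - z‖ / 2)⁻¹ := inv_anti₀ (by linarith) h1
        _ = 2 * ‖ζ i - z‖⁻¹ := by rw [inv_div, div_eq_mul_inv]
  exact hc.continuousAt (Metric.ball_mem_nhds z (by linarith))

/-! ### Summation identities from critical points -/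

lemma sumInvProd_sub (h : LogDerivExpansion φ ζ γ) {z t : ℂ} (hz : φ z ≠ 0) (ht : φ t ≠ 0)
    {T : List ℂ} (hT : ∀ t ∈ T, φ t ≠ 0) (hT' : T ≠ []) :
    sumInvProd ζ T z - sumInvProd ζ T t = (z - t) * sumInvProd ζ (t :: T) z := by
  unfold sumInvProd
  rw [← (h.summable_inv_mul_prod hz hT hT').tsum_sub (h.summable_inv_mul_prod ht hT hT'),
    ← tsum_mul_left]
  refine tsum_congr fun i => ?_
  have h1 := h.zeros_ne hz i
  have h2 := h.zeros_ne ht i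
  rw [List.map_cons, List.prod_cons]
  field_simp
  ring

/-- Every point of `U` is a zero of `φ'` that is not a zero of `φ`, and it occurs in `U` at most
as often as its multiplicity as a zero of `φ'`. -/
def _root_.CriticalList (φ : ℂ → ℂ) (U : List ℂ) : Prop :=
  ∀ a ∈ U, φ a ≠ 0 ∧ (U.count a : ℕ∞) ≤ analyticOrderAt (deriv φ) a

lemma _root_.CriticalList.of_cons {U : List ℂ} {t : ℂ} (hU : CriticalList φ (t :: U)) :
    CriticalList φ U := fun a ha =>
  ⟨(hU a (List.mem_cons_of_mem _ ha)).1,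
    le_trans (by exact_mod_cast (List.count_le_count_cons)) (hU a (List.mem_cons_of_mem _ ha)).2⟩

lemma _root_.prod_map_sub_eq_pow_mul (T : List ℂ) (t z : ℂ) :
    (T.map fun s => z - s).prod =
      (z - t) ^ T.count t * ((T.filter (· ≠ t)).map fun s => z - s).prod := by
  induction T with
  | nil => simp
  | cons s T ih =>
    by_cases hs : s = t
    · subst hs
      rw [List.map_cons, List.prod_cons, ih, List.count_cons_self, pow_succ,
        List.filter_cons_of_neg (by simp)]
      ring
    · rw [List.map_cons, List.prod_cons, ih, List.count_cons_of_ne hs,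
        List.filter_cons_of_pos (by simpa using hs), List.map_cons, List.prod_cons]
      ring

lemma differentiable_deriv (h : LogDerivExpansion φ ζ γ) : Differentiable ℂ (deriv φ) :=
  fun z => (h.differentiable.analyticAt z).deriv.differentiableAt

/-- The order of `φ'` at `t` exceeds by at least one the number of factors `z - t` already extracted
through `T`, so the cofactor must still vanish at `t`. -/
lemma sumInvProd_add_eq_zero_of_factor (h : LogDerivExpansion φ ζ γ) {T : List ℂ} {t c : ℂ}
    (hT' : T ≠ []) (hU : CriticalList φ (t :: T))
    (hfac : ∀ z, φ z ≠ 0 →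
      logDeriv φ z = -(T.map fun s => z - s).prod * (c + sumInvProd ζ T z)) :
    c + sumInvProd ζ T t = 0 := by
  obtain ⟨ht, hord⟩ := hU t List.mem_cons_self
  have hT := hU.of_cons
  rw [List.count_cons_self, natCast_le_analyticOrderAt (h.differentiable_deriv.analyticAt t)]
    at hord
  obtain ⟨g, hg, hge⟩ := hord
  set P : ℂ → ℂ := fun z => ((T.filter (· ≠ t)).map fun s => z - s).prod with hP
  have hPc : Continuous P := by
    have : ∀ l : List ℂ, Continuous fun z : ℂ => (l.map fun s => z - s).prod := by
      intro l
      induction l with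
      | nil => simpa using continuous_const
      | cons s l ih => simp only [List.map_cons, List.prod_cons]; fun_prop
    exact this _
  have hPt : P t ≠ 0 := by
    rw [hP]
    simp only [ne_eq, List.prod_eq_zero_iff, List.mem_map, List.mem_filter, not_exists, not_and]
    rintro s ⟨-, hs⟩ h0
    simp [sub_eq_zero] at hs h0
    exact hs h0.symm
  have hne : ∀ᶠ w in 𝓝 t, φ w ≠ 0 := h.differentiable.continuous.continuousAt.eventually_ne ht
  have hF := h.continuousAt_sumInvProd ht (fun s hs => (hT s hs).1) hT'
  -- Off `t` the common power of `z - t` cancels; the resulting identity is then evaluated at `t` by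
  -- continuity of both sides.
  have heq : (fun z => (z - t) * g z) =ᶠ[𝓝[≠] t]
      fun z => -φ z * P z * (c + sumInvProd ζ T z) := by
    filter_upwards [hge.filter_mono nhdsWithin_le_nhds, hne.filter_mono nhdsWithin_le_nhds,
      eventually_mem_nhdsWithin] with z h1 h2 h3
    have h4 : z - t ≠ 0 := sub_ne_zero.2 h3
    have h5 := hfac z h2
    rw [logDeriv_apply, prod_map_sub_eq_pow_mul T t z, div_eq_iff h2, h1, smul_eq_mul,
      pow_succ] at h5
    have h6 : (z - t) ^ T.count t ≠ 0 := pow_ne_zero _ h4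
    apply mul_left_cancel₀ h6
    rw [← mul_assoc, h5]
    ring
  have hl : ContinuousAt (fun z => (z - t) * g z) t := by
    have := hg.continuousAt
    fun_prop
  have hr : ContinuousAt (fun z => -φ z * P z * (c + sumInvProd ζ T z)) t := by
    have := h.differentiable.continuous
    fun_prop
  have := tendsto_nhds_unique (hl.tendsto.mono_left nhdsWithin_le_nhds)
    ((hr.tendsto.mono_left nhdsWithin_le_nhds).congr' heq.symm)
  simp only [sub_self, zero_mul] at this
  have h7 := this.symm
  rw [mul_eq_zero] at h7
  exact h7.resolve_left (mul_ne_zero (neg_ne_zero.2 ht) hPt)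

/-- Critical points are extracted one at a time: the cofactor vanishes at the next point `t`, so it
equals its difference from its value at `t`, which carries a factor `z - t`. The constant `2γ`
cancels in the first such difference, hence appears only for a single point. -/
lemma logDeriv_eq_prod_mul (h : LogDerivExpansion φ ζ γ) {T : List ℂ} (hT' : T ≠ [])
    (hT : CriticalList φ T) (z : ℂ) (hz : φ z ≠ 0) :
    logDeriv φ z = -(T.map fun s => z - s).prod *
      ((if T.length = 1 then 2 * (γ : ℂ) else 0) + sumInvProd ζ T z) := by
  induction T generalizing z with
  | nil => exact absurd rfl hT'
  | cons t T ih =>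
    obtain ⟨ht, hord⟩ := hT t List.mem_cons_self
    have hd : logDeriv φ t = 0 := by
      have : analyticOrderAt (deriv φ) t ≠ 0 := by
        intro h0
        rw [h0, List.count_cons_self] at hord
        simp at hord
      rw [logDeriv_apply, apply_eq_zero_of_analyticOrderAt_ne_zero this, zero_div]
    rcases eq_or_ne T [] with rfl | hne
    · have := h.logDeriv_sub z t hz ht
      rw [hd, sub_zero] at this
      simpa [sumInvProd] using this
    · have ih' := fun z hz => ih hne hT.of_cons z hz
      have h0 := h.sumInvProd_add_eq_zero_of_factor hne hT ih'
      have h1 := h.sumInvProd_sub hz ht (fun s hs => (hT.of_cons s hs).1) hne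
      have h2 : (t :: T).length ≠ 1 := by simpa using hne
      rw [ih' z hz, List.map_cons, List.prod_cons, if_neg h2]
      linear_combination -(T.map fun s => z - s).prod * h1 - (T.map fun s => z - s).prod * h0

lemma hasSum_prod_inv (h : LogDerivExpansion φ ζ γ) {U : List ℂ} (hU' : 2 ≤ U.length)
    (hU : CriticalList φ U) :
    HasSum (fun i => (U.map fun t => (ζ i - t)⁻¹).prod)
      (if U.length = 2 then -(2 * (γ : ℂ)) else 0) := by
  match U, hU' with
  | t :: T, hU' =>
    have hne : T ≠ [] := by rintro rfl; simp at hU'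
    have h0 := h.sumInvProd_add_eq_zero_of_factor hne hU
      (h.logDeriv_eq_prod_mul hne hU.of_cons)
    have h1 := (h.summable_inv_mul_prod (hU t List.mem_cons_self).1
      (fun s hs => (hU.of_cons s hs).1) hne).hasSum
    change HasSum _ (sumInvProd ζ T t) at h1
    rw [eq_neg_of_add_eq_zero_right h0] at h1
    have h2 : (if (t :: T).length = 2 then -(2 * (γ : ℂ)) else 0) =
        -if T.length = 1 then 2 * (γ : ℂ) else 0 := by
      by_cases hl : T.length = 1 <;> simp [hl]
    rw [h2]
    exact h1

-- Divide `g` by `X - t` for the first point `t` of `U`: the quotient cancels one factor of the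
-- product and is handled by induction, and the remainder `g(t)` multiplies a sum that vanishes
-- because `U` has more than two points.
open Polynomial in
lemma hasSum_eval_mul_prod_inv (h : LogDerivExpansion φ ζ γ) {U : List ℂ}
    (hU : CriticalList φ U) (n : ℕ) (hn : U.length = n + 2) (g : ℂ[X]) (hg : g.natDegree ≤ n) :
    HasSum (fun i => g.eval (ζ i) * (U.map fun t => (ζ i - t)⁻¹).prod)
      (-(2 * (γ : ℂ)) * g.coeff n) := by
  induction n generalizing U g with
  | zero =>
    rw [eq_C_of_natDegree_le_zero hg]
    simpa [hn, mul_comm] using (h.hasSum_prod_inv (by lia) hU).mul_left (g.coeff 0)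
  | succ n ih =>
    match U, hn with
    | t :: T, hn =>
      have ht := (hU t List.mem_cons_self).1
      have h1 := ih hU.of_cons (by simpa using hn) (g /ₘ (X - C t)) (by
        rw [natDegree_divByMonic _ (monic_X_sub_C t), natDegree_X_sub_C]; lia)
      have h2 := (h.hasSum_prod_inv (by lia) hU).mul_left (g.eval t)
      rw [if_neg (by lia), mul_zero] at h2
      have hdec : g = (X - C t) * (g /ₘ (X - C t)) + C (g.eval t) := by
        conv_lhs => rw [← modByMonic_add_div g (X - C t), modByMonic_X_sub_C_eq_C_eval, add_comm]
      have hcoeff : g.coeff (n + 1) = (g /ₘ (X - C t)).coeff n := by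
        have h3 : (g /ₘ (X - C t)).coeff (n + 1) = 0 := coeff_eq_zero_of_natDegree_lt (by
          rw [natDegree_divByMonic _ (monic_X_sub_C t), natDegree_X_sub_C]; lia)
        conv_lhs => rw [hdec]
        simp [sub_mul, coeff_X_mul, coeff_C_succ, h3]
      have h4 := h1.add h2
      rw [add_zero, ← hcoeff] at h4
      convert h4 using 2 with i
      have h5 := h.zeros_ne ht i
      have h6 : g.eval (ζ i) = (ζ i - t) * (g /ₘ (X - C t)).eval (ζ i) + g.eval t := by
        conv_lhs => rw [hdec]
        simp
      rw [h6, List.map_cons, List.prod_cons]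
      field_simp

end LogDerivExpansion

/-! ### Real symmetry and the bound on critical points in the upper half-plane -/

/-- A logarithmic derivative expansion of a function that is real on the real axis, has only
finitely many nonreal zeros and is neither zero nor an exponential. -/
structure RealLogDerivExpansion (φ : ℂ → ℂ) {ι : Type} (ζ : ι → ℂ) (γ : ℝ) : Prop
    extends LogDerivExpansion φ ζ γ where
  exists_ne_zero : ∃ z, φ z ≠ 0
  map_conj : ∀ z, φ (conj z) = conj (φ z)
  finite_nonreal : {z | φ z = 0 ∧ z.im ≠ 0}.Finite
  nontrivial : Nonempty ι ∨ 0 < γ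

lemma deriv_conj_of_map_conj {f : ℂ → ℂ} (hf : ∀ z, f (conj z) = conj (f z)) (z : ℂ) :
    deriv f (conj z) = conj (deriv f z) := by
  have h1 : conj ∘ f ∘ conj = f := by
    funext w
    simp [hf]
  have h2 := congrFun (deriv_conj_conj (f := f)) (conj z)
  rw [h1] at h2
  simpa using h2

lemma iteratedDeriv_conj_of_map_conj {f : ℂ → ℂ} (hf : ∀ z, f (conj z) = conj (f z)) (n : ℕ)
    (z : ℂ) : iteratedDeriv n f (conj z) = conj (iteratedDeriv n f z) := by
  induction n generalizing z with
  | zero => simpa using hf z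
  | succ n ih =>
    rw [iteratedDeriv_succ]
    exact deriv_conj_of_map_conj ih z

lemma analyticOrderAt_conj_of_map_conj {f : ℂ → ℂ} (hd : Differentiable ℂ f)
    (hf : ∀ z, f (conj z) = conj (f z)) (z : ℂ) :
    analyticOrderAt f (conj z) = analyticOrderAt f z := by
  refine ENat.eq_of_forall_natCast_le_iff fun n => ?_
  rw [natCast_le_analyticOrderAt_iff_iteratedDeriv_eq_zero (hd.analyticAt _),
    natCast_le_analyticOrderAt_iff_iteratedDeriv_eq_zero (hd.analyticAt _)]
  simp [iteratedDeriv_conj_of_map_conj hf]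

lemma List.count_map_conj_of_forall_im {T : List ℂ} (hT : ∀ t ∈ T, 0 < t.im) {a : ℂ}
    (ha : 0 ≤ a.im) : (T.map conj).count a = 0 := by
  refine List.count_eq_zero_of_not_mem fun h => ?_
  obtain ⟨t, ht, rfl⟩ := List.mem_map.1 h
  have := hT t ht
  simp at ha
  linarith

namespace RealLogDerivExpansion

variable {φ : ℂ → ℂ} {ι : Type} {ζ : ι → ℂ} {γ : ℝ}

lemma analyticOrderAt_deriv_conj (h : RealLogDerivExpansion φ ζ γ) (z : ℂ) :
    analyticOrderAt (deriv φ) (conj z) = analyticOrderAt (deriv φ) z :=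
  analyticOrderAt_conj_of_map_conj h.differentiable_deriv
    (deriv_conj_of_map_conj h.map_conj) z

/-- `T` and its conjugate lie in opposite open half-planes, so their counts do not add up; only `x`
occurs twice, which its order permits. -/
lemma criticalList_append_conj (h : RealLogDerivExpansion φ ζ γ) {T : List ℂ}
    (hT : CriticalList φ T) (hT' : ∀ t ∈ T, 0 < t.im) {x : ℝ} (hx : φ x ≠ 0)
    (hx' : 2 ≤ analyticOrderAt (deriv φ) x) :
    CriticalList φ (((x : ℂ) :: T) ++ ((x : ℂ) :: T).map conj) := by
  have hup : ∀ a ∈ T, a ≠ (x : ℂ) := by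
    rintro a ha rfl
    simpa using hT' _ ha
  have hcount : ∀ a ∈ T, (((x : ℂ) :: T) ++ ((x : ℂ) :: T).map conj).count a = T.count a := by
    intro a ha
    rw [List.count_append, List.map_cons, conj_ofReal, List.count_cons_of_ne (hup a ha).symm,
      List.count_cons_of_ne (hup a ha).symm,
      List.count_map_conj_of_forall_im hT' (hT' a ha).le, add_zero]
  have hcount' : ∀ a, (((x : ℂ) :: T) ++ ((x : ℂ) :: T).map conj).count (conj a) =
      (((x : ℂ) :: T) ++ ((x : ℂ) :: T).map conj).count a := by
    intro a
    have hinj : Function.Injective (conj : ℂ → ℂ) := star_injective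
    have h1 : ∀ l : List ℂ, (l.map conj).count (conj a) = l.count a := fun l =>
      List.count_map_of_injective l _ hinj a
    have h2 : ∀ l : List ℂ, l.count (conj a) = (l.map conj).count a := fun l => by
      have := List.count_map_of_injective l _ hinj (conj a)
      rw [← this, conj_conj]
    rw [List.count_append, List.count_append, h1, h2, add_comm]
  have hcx : (((x : ℂ) :: T) ++ ((x : ℂ) :: T).map conj).count (x : ℂ) = 2 := by
    have h0 : T.count (x : ℂ) = 0 := List.count_eq_zero_of_not_mem fun h => hup _ h rfl
    rw [List.count_append, List.map_cons, conj_ofReal, List.count_cons_self,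
      List.count_cons_self, h0, List.count_map_conj_of_forall_im hT' (by simp)]
  intro a ha
  rw [List.mem_append, List.map_cons, conj_ofReal, List.mem_cons, List.mem_cons] at ha
  have hxa : a = x → φ a ≠ 0 ∧
      ((((x : ℂ) :: T) ++ ((x : ℂ) :: T).map conj).count a : ℕ∞) ≤
        analyticOrderAt (deriv φ) a := by
    rintro rfl
    exact ⟨hx, by rw [hcx]; exact hx'⟩
  rcases ha with (ha | ha) | (ha | ha)
  · exact hxa ha
  · rw [hcount a ha]
    exact hT a ha
  · exact hxa ha
  · obtain ⟨b, hb, rfl⟩ := List.mem_map.1 ha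
    rw [hcount', hcount b hb, h.analyticOrderAt_deriv_conj, h.map_conj]
    exact ⟨by simpa using (hT b hb).1, (hT b hb).2⟩

-- The conditions are `Z.card` linear equations in the `Z.card + 1` coefficients of `q`.
open Polynomial in
lemma exists_polynomial_symmetric (Z : Finset ℂ) (w : ℂ → ℂ) :
    ∃ q : ℂ[X], q ≠ 0 ∧ q.natDegree ≤ Z.card ∧
      ∀ z ∈ Z, q.eval z * w z = q.eval (conj z) * w (conj z) := by
  let f : degreeLT ℂ (Z.card + 1) →ₗ[ℂ] (Z → ℂ) :=
    { toFun := fun q z => q.1.eval z.1 * w z.1 - q.1.eval (conj z.1) * w (conj z.1)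
      map_add' := fun p q => by
        funext z
        simp only [Submodule.coe_add, eval_add, Pi.add_apply]
        ring
      map_smul' := fun c q => by
        funext z
        simp only [Submodule.coe_smul, eval_smul, Pi.smul_apply, smul_eq_mul, RingHom.id_apply]
        ring }
  have hfr : Module.finrank ℂ (Z → ℂ) < Module.finrank ℂ (degreeLT ℂ (Z.card + 1)) := by
    rw [(degreeLTEquiv ℂ (Z.card + 1)).finrank_eq]
    simp
  have : Module.Finite ℂ (degreeLT ℂ (Z.card + 1)) :=
    Module.Finite.equiv (degreeLTEquiv ℂ (Z.card + 1)).symm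
  obtain ⟨q, hq, hq0⟩ := (Submodule.ne_bot_iff _).1 (LinearMap.ker_ne_bot_of_finrank_lt (f := f) hfr)
  refine ⟨q.1, fun h0 => hq0 (Subtype.ext h0), ?_, fun z hz => ?_⟩
  · have := mem_degreeLT.1 q.2
    have h0 : q.1 ≠ 0 := fun h0 => hq0 (Subtype.ext h0)
    rw [degree_eq_natDegree h0] at this
    have h1 : q.1.natDegree < Z.card + 1 := by exact_mod_cast this
    lia
  · have := congrFun (LinearMap.mem_ker.1 hq) ⟨z, hz⟩
    exact sub_eq_zero.1 this

lemma prod_map_conj (T : List ℂ) (z : ℂ) :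
    ((T.map conj).map fun t => (z - t)⁻¹).prod = conj (T.map fun t => (conj z - t)⁻¹).prod := by
  induction T with
  | nil => simp
  | cons t T ih =>
    simp only [List.map_cons, List.prod_cons, map_mul] at ih ⊢
    rw [ih]
    simp

open Polynomial in
/-- If `φ` has `m` zeros in the upper half-plane and `φ'/φ` has a double real zero, there are no
`m` zeros of `φ'/φ` in the upper half-plane. -/
lemma length_ne_card (h : RealLogDerivExpansion φ ζ γ) {Z : Finset ℂ}
    (hZ : ∀ z, z ∈ Z ↔ φ z = 0 ∧ 0 < z.im) {x : ℝ} (hx : φ x ≠ 0)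
    (hx' : 2 ≤ analyticOrderAt (deriv φ) x) {T : List ℂ}
    (hT : CriticalList φ T) (hT' : ∀ t ∈ T, 0 < t.im) : T.length ≠ Z.card := by
  intro hlen
  set W : List ℂ := (x : ℂ) :: T with hW
  have hU := h.criticalList_append_conj hT hT' hx hx'
  rw [← hW] at hU
  obtain ⟨q, hq0, hqd, hq⟩ := exists_polynomial_symmetric Z fun z => (W.map fun t => (z - t)⁻¹).prod
  set R : ℂ → ℂ := fun z => q.eval z * (W.map fun t => (z - t)⁻¹).prod with hR
  set g : ℂ[X] := q * q.map (starRingEnd ℂ) with hg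
  have hevalconj : ∀ z, (q.map (starRingEnd ℂ)).eval z = conj (q.eval (conj z)) := by
    intro z
    have := eval_map_apply (f := starRingEnd ℂ) (p := q) (x := conj z)
    rwa [conj_conj] at this
  have hmapd : (q.map (starRingEnd ℂ)).natDegree ≤ Z.card := natDegree_map_le.trans hqd
  have hgd : g.natDegree ≤ Z.card + Z.card := natDegree_mul_le_of_le hqd hmapd
  have hgc : g.coeff (Z.card + Z.card) = ((normSq (q.coeff Z.card) : ℝ) : ℂ) := by
    rw [hg, coeff_mul_add_eq_of_natDegree_le hqd hmapd, coeff_map, mul_conj]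
  have hsum := h.hasSum_eval_mul_prod_inv hU (Z.card + Z.card) (by simp [hW, hlen]; ring) g hgd
  -- The left side is `R(ζ)` times the conjugate of `R(conj ζ)`, and `R(conj ζ) = R(ζ)` by the
  -- choice of `q`.
  have hterm : ∀ i, g.eval (ζ i) * ((W ++ W.map conj).map fun t => (ζ i - t)⁻¹).prod =
      ((normSq (R (ζ i)) : ℝ) : ℂ) := by
    intro i
    have h1 : R (ζ i) = R (conj (ζ i)) := by
      have hz : φ (ζ i) = 0 := (h.zero_iff _).2 ⟨i, rfl⟩
      rcases lt_trichotomy (ζ i).im 0 with him | him | him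
      · have := hq (conj (ζ i)) ((hZ _).2 ⟨by rw [h.map_conj, hz, map_zero], by simpa using him⟩)
        rw [conj_conj] at this
        exact this.symm
      · rw [conj_eq_iff_im.2 him]
      · exact hq _ ((hZ _).2 ⟨hz, him⟩)
    rw [hg, eval_mul, hevalconj, List.map_append, List.prod_append, prod_map_conj, ← mul_conj]
    conv_rhs => rw [h1]
    conv_rhs => enter [1]; rw [← h1]
    simp only [hR, map_mul]
    ring
  simp only [hterm] at hsum
  rw [hgc] at hsum
  have hsum' : HasSum (fun i => normSq (R (ζ i))) (-(2 * γ) * normSq (q.coeff Z.card)) := by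
    rw [← Complex.hasSum_ofReal]
    exact_mod_cast hsum
  -- A sum of nonnegative terms has a nonpositive value, so both are zero.
  have hnn : 0 ≤ γ * normSq (q.coeff Z.card) := mul_nonneg h.gamma_nonneg (normSq_nonneg _)
  have hge := hsum'.nonneg fun i => normSq_nonneg _
  have hval : γ * normSq (q.coeff Z.card) = 0 := by nlinarith
  have hz0 : -(2 * γ) * normSq (q.coeff Z.card) = 0 := by linear_combination -2 * hval
  rw [hz0, hasSum_zero_iff_of_nonneg fun i => normSq_nonneg _] at hsum'
  have hroot : ∀ i, q.eval (ζ i) = 0 := by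
    intro i
    have h1 : R (ζ i) = 0 := normSq_eq_zero.1 (congrFun hsum' i)
    refine (mul_eq_zero.1 h1).resolve_right fun h2 => ?_
    rw [List.prod_eq_zero_iff, List.mem_map] at h2
    obtain ⟨t, ht, h3⟩ := h2
    exact inv_ne_zero (h.zeros_ne (hU t (List.mem_append_left _ ht)).1 i) h3
  have hroot' : ∀ z, φ z = 0 → q.eval z = 0 := by
    intro z hz
    obtain ⟨i, rfl⟩ := (h.zero_iff z).1 hz
    exact hroot i
  -- The zeros in `Z` and their conjugates are twice `Z.card` roots of a nonzero polynomial of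
  -- degree at most `Z.card`, so `Z` is empty and `q` is a nonzero constant.
  have hcard : (Z ∪ Z.image conj).card ≤ q.natDegree := by
    refine card_le_degree_of_subset_roots ?_
    intro z hz
    rw [Finset.mem_val, Finset.mem_union, Finset.mem_image] at hz
    rw [mem_roots hq0, IsRoot.def]
    apply hroot'
    rcases hz with hz | ⟨w, hw, rfl⟩
    · exact ((hZ z).1 hz).1
    · rw [h.map_conj, ((hZ w).1 hw).1, map_zero]
  have hdisj : Disjoint Z (Z.image conj) := by
    rw [Finset.disjoint_left]
    intro z hz hz'
    obtain ⟨w, hw, rfl⟩ := Finset.mem_image.1 hz'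
    have h1 := ((hZ _).1 hz).2
    have h2 := ((hZ _).1 hw).2
    simp at h1
    linarith
  rw [Finset.card_union_of_disjoint hdisj, Finset.card_image_of_injective _ (starRingEnd ℂ).injective] at hcard
  have hm : Z.card = 0 := by lia
  have hqC : q = C (q.coeff 0) := eq_C_of_natDegree_le_zero (by lia)
  have hc : q.coeff 0 ≠ 0 := by
    intro h0
    rw [h0, map_zero] at hqC
    exact hq0 hqC
  rcases h.nontrivial with ⟨⟨i⟩⟩ | hγ
  · have := hroot i
    rw [hqC, eval_C] at this
    exact hc this
  · rw [hm] at hval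
    exact hc (normSq_eq_zero.1 ((mul_eq_zero.1 hval).resolve_left hγ.ne'))

end RealLogDerivExpansion

/-! ### Counting nonreal zeros of the derivative -/

lemma zeroMultiplicity_eq_analyticOrderAt {f : ℂ → ℂ} {z : ℂ} (hf : AnalyticAt ℂ f z) :
    zeroMultiplicity f z = analyticOrderAt f z := by
  unfold zeroMultiplicity
  rw [hf.meromorphicOrderAt_eq]
  cases analyticOrderAt f z <;> rfl

lemma sum_zeroMultiplicity_le_zeroCount {X : Set ℂ} (f : ℂ → ℂ) {s : Finset ℂ}
    (hs : (s : Set ℂ) ⊆ X) : ∑ z ∈ s, zeroMultiplicity f z ≤ zeroCount X f :=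
  le_iSup₂ (f := fun (s : Finset ℂ) (_ : (s : Set ℂ) ⊆ X) => ∑ z ∈ s, zeroMultiplicity f z) s hs

/-- Built greedily: as long as the list is shorter than the total of `f`, some point has
multiplicity to spare. -/
lemma exists_list_count_le_of_le_sum (s : Finset ℂ) (f : ℂ → ℕ∞) (m : ℕ)
    (hm : (m : ℕ∞) ≤ ∑ a ∈ s, f a) :
    ∃ T : List ℂ, T.length = m ∧ ∀ a ∈ T, a ∈ s ∧ (T.count a : ℕ∞) ≤ f a := by
  induction m with
  | zero => exact ⟨[], rfl, by simp⟩
  | succ m ih =>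
    obtain ⟨T, hl, hT⟩ := ih (le_trans (by exact_mod_cast m.le_succ) hm)
    have : ∃ a ∈ s, (T.count a : ℕ∞) < f a := by
      by_contra! hcon
      have h1 : ∑ a ∈ s, f a ≤ ∑ a ∈ s, (T.count a : ℕ∞) := Finset.sum_le_sum hcon
      have h2 : ∑ a ∈ s, T.count a = m := by
        have := Multiset.sum_count_eq_card (s := s) (m := (T : Multiset ℂ)) fun a ha => (hT a ha).1
        simpa [hl] using this
      rw [← Nat.cast_sum, h2] at h1
      have h3 := hm.trans h1
      have h4 : m + 1 ≤ m := by exact_mod_cast h3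
      lia
    obtain ⟨b, hb, hlt⟩ := this
    refine ⟨b :: T, by simp [hl], fun a ha => ?_⟩
    by_cases hab : a = b
    · subst hab
      rw [List.count_cons_self]
      exact ⟨hb, by exact_mod_cast Order.add_one_le_of_lt hlt⟩
    · rw [List.count_cons_of_ne (Ne.symm hab)]
      exact hT a ((List.mem_cons.1 ha).resolve_left hab)

namespace RealLogDerivExpansion

variable {φ : ℂ → ℂ} {ι : Type} {ζ : ι → ℂ} {γ : ℝ}

lemma sum_order_deriv_lt (h : RealLogDerivExpansion φ ζ γ) {Z : Finset ℂ}
    (hZ : ∀ z, z ∈ Z ↔ φ z = 0 ∧ 0 < z.im) {x : ℝ} (hx : φ x ≠ 0)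
    (hx' : 2 ≤ analyticOrderAt (deriv φ) x) {s : Finset ℂ}
    (hs : ∀ a ∈ s, φ a ≠ 0 ∧ 0 < a.im) :
    ∑ a ∈ s, analyticOrderAt (deriv φ) a < Z.card := by
  by_contra! hcon
  obtain ⟨T, hl, hT⟩ := exists_list_count_le_of_le_sum s _ _ hcon
  exact h.length_ne_card hZ hx hx' (fun a ha => ⟨(hs a (hT a ha).1).1, (hT a ha).2⟩)
    (fun a ha => (hs a (hT a ha).1).2) hl

lemma sum_order_deriv_lt' (h : RealLogDerivExpansion φ ζ γ) {Z : Finset ℂ}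
    (hZ : ∀ z, z ∈ Z ↔ φ z = 0 ∧ 0 < z.im) {x : ℝ} (hx : φ x ≠ 0)
    (hx' : 2 ≤ analyticOrderAt (deriv φ) x) {s : Finset ℂ}
    (hs : ∀ a ∈ s, φ a ≠ 0 ∧ a.im < 0) :
    ∑ a ∈ s, analyticOrderAt (deriv φ) a < Z.card := by
  have h1 := h.sum_order_deriv_lt hZ hx hx' (s := s.image conj) (by
    intro a ha
    obtain ⟨b, hb, rfl⟩ := Finset.mem_image.1 ha
    rw [h.map_conj]
    exact ⟨by simpa using (hs b hb).1, by simpa using (hs b hb).2⟩)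
  rw [Finset.sum_image fun a _ b _ hab => (starRingEnd ℂ).injective hab] at h1
  simpa only [h.analyticOrderAt_deriv_conj] using h1

lemma analyticOrderAt_ne_top (h : RealLogDerivExpansion φ ζ γ) (z : ℂ) :
    analyticOrderAt φ z ≠ ⊤ := by
  obtain ⟨x, hx⟩ := h.exists_ne_zero
  have hd : AnalyticOnNhd ℂ φ Set.univ := fun z _ => h.differentiable.analyticAt z
  refine hd.analyticOrderAt_ne_top_of_isPreconnected isPreconnected_univ (Set.mem_univ x)
    (Set.mem_univ z) ?_
  rw [(h.differentiable.analyticAt x).analyticOrderAt_eq_zero.2 hx]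
  simp

lemma analyticOrderAt_deriv_add_one (h : RealLogDerivExpansion φ ζ γ) {z : ℂ} (hz : φ z = 0) :
    analyticOrderAt (deriv φ) z + 1 = analyticOrderAt φ z := by
  rw [(h.differentiable.analyticAt z).analyticOrderAt_deriv_add_one]
  simp [hz]

/-- If the logarithmic derivative of `φ` has a multiple real zero, then `φ'` has fewer nonreal
zeros than `φ`. -/
theorem nonrealZeroCount_deriv_lt (h : RealLogDerivExpansion φ ζ γ) {x : ℝ} (hx : φ x ≠ 0)
    (hx' : 2 ≤ analyticOrderAt (deriv φ) x) :
    nonrealZeroCount (deriv φ) < nonrealZeroCount φ := by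
  classical
  set N : Finset ℂ := h.finite_nonreal.toFinset with hN
  have hNmem : ∀ z, z ∈ N ↔ φ z = 0 ∧ z.im ≠ 0 := by simp [hN]
  set Z : Finset ℂ := N.filter fun z => 0 < z.im with hZdef
  have hZ : ∀ z, z ∈ Z ↔ φ z = 0 ∧ 0 < z.im := by
    intro z
    rw [hZdef, Finset.mem_filter, hNmem]
    exact ⟨fun h => ⟨h.1.1, h.2⟩, fun h => ⟨⟨h.1, h.2.ne'⟩, h.2⟩⟩
  have hcard : Z.card + Z.card ≤ N.card := by
    have hdisj : Disjoint Z (Z.image conj) := by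
      rw [Finset.disjoint_left]
      intro z hz hz'
      obtain ⟨w, hw, rfl⟩ := Finset.mem_image.1 hz'
      have h1 := ((hZ _).1 hz).2
      have h2 := ((hZ _).1 hw).2
      simp at h1
      linarith
    have h1 : Z ∪ Z.image conj ⊆ N := by
      intro z hz
      rw [Finset.mem_union, Finset.mem_image] at hz
      rw [hNmem]
      rcases hz with hz | ⟨w, hw, rfl⟩
      · exact ⟨((hZ z).1 hz).1, ((hZ z).1 hz).2.ne'⟩
      · rw [h.map_conj, ((hZ w).1 hw).1]
        simpa using ((hZ w).1 hw).2.ne'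
    have h2 := Finset.card_le_card h1
    rwa [Finset.card_union_of_disjoint hdisj,
      Finset.card_image_of_injective _ (starRingEnd ℂ).injective] at h2
  have hmul : ∀ z, zeroMultiplicity φ z = analyticOrderAt φ z := fun z =>
    zeroMultiplicity_eq_analyticOrderAt (h.differentiable.analyticAt z)
  have hmul' : ∀ z, zeroMultiplicity (deriv φ) z = analyticOrderAt (deriv φ) z := fun z =>
    zeroMultiplicity_eq_analyticOrderAt (h.differentiable_deriv.analyticAt z)
  have hlow : ∑ z ∈ N, analyticOrderAt φ z ≤ nonrealZeroCount φ := by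
    simp only [← hmul]
    exact sum_zeroMultiplicity_le_zeroCount φ fun z hz => ((hNmem z).1 hz).2
  have hsumN : ∑ z ∈ N, analyticOrderAt φ z =
      ∑ z ∈ N, analyticOrderAt (deriv φ) z + (N.card : ℕ∞) := by
    rw [← Finset.sum_congr rfl fun z hz => h.analyticOrderAt_deriv_add_one ((hNmem z).1 hz).1,
      Finset.sum_add_distrib]
    simp
  -- Finiteness is what later makes the comparison in `ℕ∞` strict.
  have hfin : ∑ z ∈ N, analyticOrderAt (deriv φ) z ≠ ⊤ := by
    refine ne_of_lt (lt_of_le_of_lt (b := ∑ z ∈ N, analyticOrderAt φ z) ?_ ?_)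
    · rw [hsumN]
      exact le_self_add
    · exact WithTop.sum_lt_top.2 fun z _ => lt_top_iff_ne_top.2 (h.analyticOrderAt_ne_top z)
  obtain ⟨d, hd⟩ := ENat.ne_top_iff_exists.1 hfin
  -- Nonreal zeros of `φ'` are either zeros of `φ`, contributing at most `d`, or new ones, at most
  -- `Z.card - 1` in each half-plane.
  have hupper : ∀ s : Finset ℂ, (s : Set ℂ) ⊆ {z : ℂ | z.im ≠ 0} →
      ∑ z ∈ s, zeroMultiplicity (deriv φ) z ≤ ((d + (N.card - 1) : ℕ) : ℕ∞) := by
    intro s hs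
    simp only [hmul']
    set s₁ := s.filter fun z => φ z = 0
    set s₂ := (s.filter fun z => ¬ φ z = 0).filter fun z => 0 < z.im with hs₂
    set s₃ := (s.filter fun z => ¬ φ z = 0).filter fun z => ¬ 0 < z.im with hs₃
    have e1 : ∑ z ∈ s, analyticOrderAt (deriv φ) z = ∑ z ∈ s₁, analyticOrderAt (deriv φ) z +
        (∑ z ∈ s₂, analyticOrderAt (deriv φ) z + ∑ z ∈ s₃, analyticOrderAt (deriv φ) z) := by
      rw [Finset.sum_filter_add_sum_filter_not, Finset.sum_filter_add_sum_filter_not]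
    have b1 : ∑ z ∈ s₁, analyticOrderAt (deriv φ) z ≤ (d : ℕ∞) := by
      rw [hd]
      refine Finset.sum_le_sum_of_subset fun z hz => ?_
      rw [Finset.mem_filter] at hz
      exact (hNmem z).2 ⟨hz.2, hs hz.1⟩
    have b2 : ∑ z ∈ s₂, analyticOrderAt (deriv φ) z < Z.card := by
      refine h.sum_order_deriv_lt hZ hx hx' fun a ha => ?_
      rw [hs₂, Finset.mem_filter, Finset.mem_filter] at ha
      exact ⟨ha.1.2, ha.2⟩
    have b3 : ∑ z ∈ s₃, analyticOrderAt (deriv φ) z < Z.card := by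
      refine h.sum_order_deriv_lt' hZ hx hx' fun a ha => ?_
      rw [hs₃, Finset.mem_filter, Finset.mem_filter] at ha
      exact ⟨ha.1.2, lt_of_le_of_ne (not_lt.1 ha.2) (hs ha.1.1)⟩
    obtain ⟨k₂, hk₂⟩ := ENat.ne_top_iff_exists.1 b2.ne_top
    obtain ⟨k₃, hk₃⟩ := ENat.ne_top_iff_exists.1 b3.ne_top
    rw [← hk₂] at b2
    rw [← hk₃] at b3
    have b2' : k₂ < Z.card := by exact_mod_cast b2
    have b3' : k₃ < Z.card := by exact_mod_cast b3
    rw [e1, ← hk₂, ← hk₃]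
    calc ∑ z ∈ s₁, analyticOrderAt (deriv φ) z + ((k₂ : ℕ∞) + (k₃ : ℕ∞))
        ≤ (d : ℕ∞) + ((k₂ : ℕ∞) + (k₃ : ℕ∞)) := by gcongr
      _ = ((d + (k₂ + k₃) : ℕ) : ℕ∞) := by push_cast; rfl
      _ ≤ _ := by
        have : d + (k₂ + k₃) ≤ d + (N.card - 1) := by lia
        exact_mod_cast this
  -- The strict bound for the empty set already forces `φ` to have a nonreal zero.
  have hpos : 0 < N.card := by
    have := h.sum_order_deriv_lt hZ hx hx' (s := ∅) (by simp)
    have h0 : 0 < Z.card := by simpa using this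
    lia
  calc nonrealZeroCount (deriv φ) ≤ ((d + (N.card - 1) : ℕ) : ℕ∞) := iSup₂_le hupper
    _ < ((d + N.card : ℕ) : ℕ∞) := by
      have : d + (N.card - 1) < d + N.card := by lia
      exact_mod_cast this
    _ = ∑ z ∈ N, analyticOrderAt φ z := by rw [hsumN, ← hd]; push_cast; rfl
    _ ≤ nonrealZeroCount φ := hlow

end RealLogDerivExpansion

/-! ### Expansions for the factors of a function in the class -/

/-- The function `φ` has a logarithmic derivative expansion for some family of zeros. -/
def HasLogDerivExpansion (φ : ℂ → ℂ) : Prop :=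
  ∃ (ι : Type) (ζ : ι → ℂ) (γ : ℝ), LogDerivExpansion φ ζ γ

lemma LogDerivExpansion.mul {f g : ℂ → ℂ} {ι κ : Type} {ζ : ι → ℂ} {ξ : κ → ℂ} {γ δ : ℝ}
    (hf : LogDerivExpansion f ζ γ) (hg : LogDerivExpansion g ξ δ) :
    LogDerivExpansion (fun z => f z * g z) (Sum.elim ζ ξ) (γ + δ) where
  differentiable := hf.differentiable.mul hg.differentiable
  gamma_nonneg := add_nonneg hf.gamma_nonneg hg.gamma_nonneg
  zero_iff z := by
    rw [mul_eq_zero, hf.zero_iff, hg.zero_iff]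
    simp
  summable z hz := by
    obtain ⟨h1, h2⟩ := mul_ne_zero_iff.1 hz
    exact Summable.sum _ (hf.summable z h1) (hg.summable z h2)
  logDeriv_sub z t hz ht := by
    obtain ⟨hz1, hz2⟩ := mul_ne_zero_iff.1 hz
    obtain ⟨ht1, ht2⟩ := mul_ne_zero_iff.1 ht
    have h1 : HasSum (fun i => (ζ i - z)⁻¹ * (ζ i - t)⁻¹)
        (∑' i, (ζ i - z)⁻¹ * (ζ i - t)⁻¹) :=
      (Summable.of_norm (by simpa only [norm_mul] using
        hf.summable_norm_inv_mul_inv hz1 ht1)).hasSum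
    have h2 : HasSum (fun i => (ξ i - z)⁻¹ * (ξ i - t)⁻¹)
        (∑' i, (ξ i - z)⁻¹ * (ξ i - t)⁻¹) :=
      (Summable.of_norm (by simpa only [norm_mul] using
        hg.summable_norm_inv_mul_inv hz2 ht2)).hasSum
    have h3 := HasSum.sum (f := fun i => (Sum.elim ζ ξ i - z)⁻¹ * (Sum.elim ζ ξ i - t)⁻¹) h1 h2
    rw [h3.tsum_eq, logDeriv_mul z hz1 hz2 hf.differentiable.differentiableAt
      hg.differentiable.differentiableAt, logDeriv_mul t ht1 ht2
      hf.differentiable.differentiableAt hg.differentiable.differentiableAt]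
    push_cast
    linear_combination hf.logDeriv_sub z t hz1 ht1 + hg.logDeriv_sub z t hz2 ht2

lemma HasLogDerivExpansion.mul {f g : ℂ → ℂ} (hf : HasLogDerivExpansion f)
    (hg : HasLogDerivExpansion g) : HasLogDerivExpansion fun z => f z * g z := by
  obtain ⟨ι, ζ, γ, hf⟩ := hf
  obtain ⟨κ, ξ, δ, hg⟩ := hg
  exact ⟨_, _, _, hf.mul hg⟩

lemma hasLogDerivExpansion_const {c : ℂ} (hc : c ≠ 0) : HasLogDerivExpansion fun _ => c :=
  ⟨Empty, Empty.elim, 0,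
    { differentiable := by fun_prop
      gamma_nonneg := le_rfl
      zero_iff := fun z => by simpa using hc
      summable := fun z _ => summable_empty
      logDeriv_sub := fun z t _ _ => by simp [logDeriv_apply] }⟩

lemma hasLogDerivExpansion_sub_const (a : ℂ) : HasLogDerivExpansion fun z => z - a :=
  ⟨Unit, fun _ => a, 0,
    { differentiable := by fun_prop
      gamma_nonneg := le_rfl
      zero_iff := fun z => by simp [sub_eq_zero, eq_comm]
      summable := fun z _ => Summable.of_finite
      logDeriv_sub := fun z t hz ht => by
        have hz' : a - z ≠ 0 := fun h => hz (by linear_combination -h)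
        have ht' : a - t ≠ 0 := fun h => ht (by linear_combination -h)
        simp only [logDeriv_apply, deriv_sub_const_fun, deriv_id'', tsum_fintype,
          Finset.univ_unique, Finset.sum_const, Finset.card_singleton, one_smul]
        push_cast
        field_simp
        ring }⟩

lemma logDerivExpansion_exp (β : ℝ) {γ : ℝ} (hγ : 0 ≤ γ) :
    LogDerivExpansion (fun z => exp (-(γ : ℂ) * z ^ 2 + (β : ℂ) * z)) Empty.elim γ where
  differentiable := by fun_prop
  gamma_nonneg := hγ
  zero_iff z := by simp [exp_ne_zero]
  summable z _ := summable_empty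
  logDeriv_sub z t _ _ := by
    have h : ∀ w, logDeriv (fun z => exp (-(γ : ℂ) * z ^ 2 + (β : ℂ) * z)) w =
        -(γ : ℂ) * (2 * w) + β := by
      intro w
      have h1 : HasDerivAt (fun z : ℂ => -(γ : ℂ) * z ^ 2 + (β : ℂ) * z)
          (-(γ : ℂ) * (2 * w) + β) w := by
        have h2 := ((hasDerivAt_pow 2 w).const_mul (-(γ : ℂ))).fun_add
          ((hasDerivAt_id w).const_mul (β : ℂ))
        simpa using h2
      rw [logDeriv_apply, h1.cexp.deriv, mul_div_cancel_left₀ _ (exp_ne_zero _)]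
    rw [h, h]
    simp
    ring

open Polynomial in
lemma hasLogDerivExpansion_eval {p : ℂ[X]} (hp : p ≠ 0) : HasLogDerivExpansion fun z => p.eval z := by
  have h1 : ∀ s : Multiset ℂ, HasLogDerivExpansion fun z => (s.map fun a => z - a).prod := by
    intro s
    induction s using Multiset.induction_on with
    | empty => simpa using hasLogDerivExpansion_const one_ne_zero
    | cons a s ih =>
      simp only [Multiset.map_cons, Multiset.prod_cons]
      exact (hasLogDerivExpansion_sub_const a).mul ih
  simp only [(IsAlgClosed.splits p).eval_eq_prod_roots]
  exact (hasLogDerivExpansion_const (leadingCoeff_ne_zero.2 hp)).mul (h1 _)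

section Product

variable {J : Type} {α : J → ℝ}

lemma eventually_le_abs (hα : ∀ j, α j ≠ 0) (hs : Summable fun j => ((α j) ^ 2)⁻¹) (R : ℝ) :
    ∀ᶠ j in Filter.cofinite, R ≤ |α j| := by
  have hpos : (0 : ℝ) < ((|R| + 1) ^ 2)⁻¹ := by positivity
  filter_upwards [hs.tendsto_cofinite_zero.eventually_lt_const hpos] with j hj
  have h1 : (|R| + 1) ^ 2 < (α j) ^ 2 := by
    have : 0 < (α j) ^ 2 := by have := hα j; positivity
    exact (inv_lt_inv₀ this (by positivity)).1 hj
  rw [← sq_abs (α j)] at h1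
  have h2 := lt_of_pow_lt_pow_left₀ 2 (abs_nonneg _) h1
  have := le_abs_self R
  linarith

lemma norm_one_sub_mul_exp_sub_one_le {u : ℂ} (hu : ‖u‖ ≤ 1) :
    ‖(1 - u) * exp u - 1‖ ≤ 3 * ‖u‖ ^ 2 := by
  have h1 : (1 - u) * exp u - 1 = (1 - u) * (exp u - 1 - u) - u ^ 2 := by ring
  have h2 := norm_exp_sub_one_sub_id_le hu
  have h3 : ‖1 - u‖ ≤ 2 := (norm_sub_le _ _).trans (by simp; linarith)
  rw [h1]
  calc ‖(1 - u) * (exp u - 1 - u) - u ^ 2‖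
      ≤ ‖1 - u‖ * ‖exp u - 1 - u‖ + ‖u‖ ^ 2 := by
        refine (norm_sub_le _ _).trans ?_
        rw [norm_mul, norm_pow]
    _ ≤ 2 * ‖u‖ ^ 2 + ‖u‖ ^ 2 := by gcongr
    _ = 3 * ‖u‖ ^ 2 := by ring

/-- All but finitely many `α j` have modulus at least `R`; there `(1 - u)e^u = 1 + O(u²)` applies
with `u = z / α j`. -/
lemma eventually_norm_factor_sub_one_le (hα : ∀ j, α j ≠ 0)
    (hs : Summable fun j => ((α j) ^ 2)⁻¹) (R : ℝ) :
    ∀ᶠ j in Filter.cofinite, ∀ z ∈ Metric.ball (0 : ℂ) R,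
      ‖(1 - z / (α j : ℂ)) * exp (z / (α j : ℂ)) - 1‖ ≤ 3 * R ^ 2 * ((α j) ^ 2)⁻¹ := by
  filter_upwards [eventually_le_abs hα hs R] with j hj z hz
  rw [mem_ball_zero_iff] at hz
  have hpos : 0 < |α j| := abs_pos.2 (hα j)
  have h1 : ‖z / (α j : ℂ)‖ ≤ R / |α j| := by
    rw [norm_div, norm_real, Real.norm_eq_abs]
    gcongr
  refine (norm_one_sub_mul_exp_sub_one_le (h1.trans ((div_le_one hpos).2 hj))).trans ?_
  calc 3 * ‖z / (α j : ℂ)‖ ^ 2 ≤ 3 * (R / |α j|) ^ 2 := by gcongr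
    _ = 3 * R ^ 2 * ((α j) ^ 2)⁻¹ := by rw [div_pow, sq_abs]; ring

lemma hasProdLocallyUniformlyOn_ball (hα : ∀ j, α j ≠ 0)
    (hs : Summable fun j => ((α j) ^ 2)⁻¹) (R : ℝ) :
    HasProdLocallyUniformlyOn
      (fun j z => (1 - z / (α j : ℂ)) * exp (z / (α j : ℂ)))
      (fun z => ∏' j, (1 - z / (α j : ℂ)) * exp (z / (α j : ℂ))) (Metric.ball (0 : ℂ) R) := by
  have := Summable.hasProdLocallyUniformlyOn_one_add
    (f := fun j z => (1 - z / (α j : ℂ)) * exp (z / (α j : ℂ)) - 1)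
    (K := Metric.ball (0 : ℂ) R) Metric.isOpen_ball (hs.mul_left (3 * R ^ 2))
    (eventually_norm_factor_sub_one_le hα hs R) (fun j => by fun_prop)
  simpa only [add_sub_cancel] using this

lemma tprod_factor_eq_zero_iff (hα : ∀ j, α j ≠ 0) (hs : Summable fun j => ((α j) ^ 2)⁻¹)
    (z : ℂ) : ∏' j, (1 - z / (α j : ℂ)) * exp (z / (α j : ℂ)) = 0 ↔ ∃ j, (α j : ℂ) = z := by
  have hfac : ∀ j, (1 - z / (α j : ℂ)) * exp (z / (α j : ℂ)) = 0 ↔ (α j : ℂ) = z := by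
    intro j
    have h1 : (α j : ℂ) ≠ 0 := by exact_mod_cast hα j
    rw [mul_eq_zero, or_iff_left (exp_ne_zero _), sub_eq_zero, eq_div_iff h1, one_mul]
  constructor
  · intro h
    by_contra! hne
    have h1 : Summable fun j => ‖(1 - z / (α j : ℂ)) * exp (z / (α j : ℂ)) - 1‖ := by
      refine Summable.of_norm_bounded_eventually (hs.mul_left (3 * (‖z‖ + 1) ^ 2)) ?_
      filter_upwards [eventually_norm_factor_sub_one_le hα hs (‖z‖ + 1)] with j hj
      rw [norm_norm]
      exact hj z (by rw [mem_ball_zero_iff]; linarith)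
    have h2 := tprod_one_add_ne_zero_of_summable (fun j => by
      rw [add_sub_cancel]
      exact mt (hfac j).1 (hne j)) h1
    simp only [add_sub_cancel] at h2
    exact h2 h
  · rintro ⟨j, hj⟩
    exact tprod_of_exists_eq_zero ⟨j, (hfac j).2 hj⟩

lemma summable_inv_sq_norm_sub (hα : ∀ j, α j ≠ 0) (hs : Summable fun j => ((α j) ^ 2)⁻¹)
    (z : ℂ) : Summable fun j => (‖(α j : ℂ) - z‖ ^ 2)⁻¹ := by
  refine Summable.of_norm_bounded_eventually (hs.mul_left 4) ?_
  filter_upwards [eventually_le_abs hα hs (2 * ‖z‖)] with j hj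
  have hpos : 0 < |α j| := abs_pos.2 (hα j)
  have h1 : |α j| / 2 ≤ ‖(α j : ℂ) - z‖ := by
    have := norm_sub_norm_le (α j : ℂ) z
    rw [norm_real, Real.norm_eq_abs] at this
    linarith
  rw [Real.norm_of_nonneg (by positivity)]
  calc (‖(α j : ℂ) - z‖ ^ 2)⁻¹ ≤ ((|α j| / 2) ^ 2)⁻¹ := by gcongr
    _ = 4 * ((α j) ^ 2)⁻¹ := by rw [div_pow, sq_abs, inv_div]; ring

lemma logDeriv_factor {a : ℝ} (ha : a ≠ 0) {z : ℂ} (hz : (a : ℂ) ≠ z) :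
    logDeriv (fun z : ℂ => (1 - z / (a : ℂ)) * exp (z / (a : ℂ))) z =
      -((a : ℂ) - z)⁻¹ + (a : ℂ)⁻¹ := by
  have ha' : (a : ℂ) ≠ 0 := by exact_mod_cast ha
  have h0 : (a : ℂ) - z ≠ 0 := sub_ne_zero.2 hz
  have h1 : HasDerivAt (fun z : ℂ => z / (a : ℂ)) (1 / (a : ℂ)) z :=
    (hasDerivAt_id z).div_const _
  have h2 := (h1.const_sub 1).mul h1.cexp
  have h3 : 1 - z / (a : ℂ) = ((a : ℂ) - z) / a := by field_simp
  rw [logDeriv_apply]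
  erw [h2.deriv]
  rw [h3]
  have := exp_ne_zero (z / (a : ℂ))
  field_simp

lemma summable_logDeriv_factor (hα : ∀ j, α j ≠ 0) (hs : Summable fun j => ((α j) ^ 2)⁻¹)
    {z : ℂ} (hz : ∀ j, (α j : ℂ) ≠ z) :
    Summable fun j => -((α j : ℂ) - z)⁻¹ + (α j : ℂ)⁻¹ := by
  refine Summable.of_norm_bounded (((summable_inv_sq_norm_sub hα hs z).add hs).mul_left ‖z‖)
    fun j => ?_
  have ha' : (α j : ℂ) ≠ 0 := by exact_mod_cast hα j
  have h0 : (α j : ℂ) - z ≠ 0 := sub_ne_zero.2 (hz j)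
  have h1 : -((α j : ℂ) - z)⁻¹ + (α j : ℂ)⁻¹ = -z * (((α j : ℂ) - z)⁻¹ * (α j : ℂ)⁻¹) := by
    field_simp
    ring
  rw [h1, norm_mul, norm_neg, norm_mul]
  gcongr
  have h2 := two_mul_le_add_sq ‖((α j : ℂ) - z)⁻¹‖ ‖(α j : ℂ)⁻¹‖
  have h3 : 0 ≤ ‖((α j : ℂ) - z)⁻¹‖ * ‖(α j : ℂ)⁻¹‖ := by positivity
  have h4 : ((α j) ^ 2)⁻¹ = ‖(α j : ℂ)⁻¹‖ ^ 2 := by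
    rw [norm_inv, norm_real, inv_pow, Real.norm_eq_abs, sq_abs]
  rw [h4, ← inv_pow, ← norm_inv]
  linarith

/-- Each factor contributes `-1 / (α j - z) + 1 / α j`; the regularising term `1 / α j` cancels in
the difference of two values of the logarithmic derivative. -/
lemma logDerivExpansion_tprod (hα : ∀ j, α j ≠ 0) (hs : Summable fun j => ((α j) ^ 2)⁻¹) :
    LogDerivExpansion (fun z => ∏' j, (1 - z / (α j : ℂ)) * exp (z / (α j : ℂ)))
      (fun j => (α j : ℂ)) 0 where
  differentiable z := by
    have h1 := hasProdLocallyUniformlyOn_ball hα hs (‖z‖ + 1)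
    have h2 := TendstoLocallyUniformlyOn.differentiableOn h1
      (Filter.Eventually.of_forall fun s => by fun_prop) Metric.isOpen_ball
    exact h2.differentiableAt (Metric.isOpen_ball.mem_nhds (by
      rw [mem_ball_zero_iff]; linarith))
  gamma_nonneg := le_rfl
  zero_iff := tprod_factor_eq_zero_iff hα hs
  summable z _ := summable_inv_sq_norm_sub hα hs z
  logDeriv_sub z t hz ht := by
    have hne : ∀ w : ℂ, ∏' j, (1 - w / (α j : ℂ)) * exp (w / (α j : ℂ)) ≠ 0 →
        (∀ j, (α j : ℂ) ≠ w) := by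
      intro w hw j hj
      exact hw ((tprod_factor_eq_zero_iff hα hs w).2 ⟨j, hj⟩)
    have key : ∀ w : ℂ, ∏' j, (1 - w / (α j : ℂ)) * exp (w / (α j : ℂ)) ≠ 0 →
        logDeriv (fun z => ∏' j, (1 - z / (α j : ℂ)) * exp (z / (α j : ℂ))) w =
          ∑' j, (-((α j : ℂ) - w)⁻¹ + (α j : ℂ)⁻¹) := by
      intro w hw
      have hl : ∀ j, logDeriv (fun z : ℂ => (1 - z / (α j : ℂ)) * exp (z / (α j : ℂ))) w =
          -((α j : ℂ) - w)⁻¹ + (α j : ℂ)⁻¹ := fun j => logDeriv_factor (hα j) (hne w hw j)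
      have hsum : Summable fun j =>
          logDeriv (fun z : ℂ => (1 - z / (α j : ℂ)) * exp (z / (α j : ℂ))) w := by
        simp only [hl]
        exact summable_logDeriv_factor hα hs (hne w hw)
      rw [logDeriv_tprod_eq_tsum (s := Metric.ball (0 : ℂ) (‖w‖ + 1))
        (f := fun j (z : ℂ) => (1 - z / (α j : ℂ)) * exp (z / (α j : ℂ)))
        Metric.isOpen_ball (by rw [mem_ball_zero_iff]; linarith)
        (fun j h0 => hw (tprod_of_exists_eq_zero ⟨j, h0⟩)) (fun j => by fun_prop) hsum
        (hasProdLocallyUniformlyOn_ball hα hs _).multipliableLocallyUniformlyOn hw]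
      exact tsum_congr hl
    rw [key z hz, key t ht, ← (summable_logDeriv_factor hα hs (hne z hz)).tsum_sub
      (summable_logDeriv_factor hα hs (hne t ht))]
    simp only [ofReal_zero, mul_zero, zero_add]
    rw [← tsum_mul_left]
    refine tsum_congr fun j => ?_
    have h0 : (α j : ℂ) - z ≠ 0 := sub_ne_zero.2 (hne z hz j)
    have h1 : (α j : ℂ) - t ≠ 0 := sub_ne_zero.2 (hne t ht j)
    field_simp
    ring

end Product

/-- Without zeros and with `γ = 0` the logarithmic derivative is constant, and conjugation symmetry
makes the constants real. This turns the excluded form into the field `nontrivial`. -/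
lemma LogDerivExpansion.eq_const_mul_exp {φ : ℂ → ℂ} {ι : Type} {ζ : ι → ℂ} [IsEmpty ι]
    (h : LogDerivExpansion φ ζ 0) (hc : ∀ z, φ (conj z) = conj (φ z)) :
    ∃ C β : ℝ, ∀ z : ℂ, φ z = (C : ℂ) * exp ((β : ℂ) * z) := by
  have hne : ∀ z, φ z ≠ 0 := fun z hz => by
    obtain ⟨i, -⟩ := (h.zero_iff z).1 hz
    exact isEmptyElim i
  have hreal : ∀ w : ℂ, conj w = w → ((w.re : ℝ) : ℂ) = w := fun w hw => conj_eq_iff_re.1 hw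
  have h0 : conj (φ 0) = φ 0 := by rw [← hc, map_zero]
  have h1 : conj (logDeriv φ 0) = logDeriv φ 0 := by
    rw [logDeriv_apply, map_div₀, ← deriv_conj_of_map_conj hc, h0, map_zero]
  have hd : ∀ z, deriv φ z = logDeriv φ 0 * φ z := by
    intro z
    have h2 : logDeriv φ z = logDeriv φ 0 := by
      simpa [sub_eq_zero] using h.logDeriv_sub z 0 (hne z) (hne 0)
    rw [← h2, logDeriv_apply, div_mul_cancel₀ _ (hne z)]
  refine ⟨(φ 0).re, (logDeriv φ 0).re, fun z => ?_⟩
  rw [hreal _ h0, hreal _ h1]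
  have h3 : ∀ z, HasDerivAt (fun z => φ z * exp (-(logDeriv φ 0 * z))) 0 z := by
    intro z
    have h4 : HasDerivAt (fun z : ℂ => -(logDeriv φ 0 * z)) (-(logDeriv φ 0)) z := by
      simpa using ((hasDerivAt_id z).const_mul (logDeriv φ 0)).fun_neg
    have h5 := (h.differentiable z).hasDerivAt.mul h4.cexp
    rw [hd z] at h5
    refine h5.congr_deriv ?_
    ring
  have h6 := is_const_of_deriv_eq_zero (fun z => (h3 z).differentiableAt)
    (fun z => (h3 z).deriv) z 0
  simp only [mul_zero, neg_zero, exp_zero, mul_one] at h6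
  rw [← h6, mul_assoc, ← exp_add]
  simp

open Polynomial in
theorem LaguerrePolyaStar.exists_realLogDerivExpansion {φ : ℂ → ℂ} (hφ : LaguerrePolyaStar φ)
    (hne : ¬ ∃ C β : ℝ, ∀ z : ℂ, φ z = (C : ℂ) * exp ((β : ℂ) * z)) :
    ∃ (ι : Type) (ζ : ι → ℂ) (γ : ℝ), RealLogDerivExpansion φ ζ γ := by
  obtain ⟨p, f, hp, ⟨c, β, γ, d, ω, α, hγ, hα, hs, hf⟩, hφ⟩ := hφ
  choose P hP hfP using hf
  have hP' : P = fun z => ∏' j, (1 - z / (α j : ℂ)) * exp (z / (α j : ℂ)) :=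
    funext fun z => (hP z).tprod_eq.symm
  have hPexp := logDerivExpansion_tprod hα hs
  rw [← hP'] at hPexp
  have hc : c ≠ 0 := by
    rintro rfl
    exact hne ⟨0, 0, fun z => by simp [hφ, hfP]⟩
  have hp0 : p ≠ 0 := by
    rintro rfl
    exact hp 0 (by simp)
  -- All polynomial factors are gathered in `q`; nonreal zeros of `φ` can only be roots of it.
  set q : ℝ[X] := p * (C c * X ^ d) with hq
  have hq0 : q ≠ 0 := mul_ne_zero hp0 (mul_ne_zero (by simpa using hc) (pow_ne_zero _ X_ne_zero))
  have hform : φ = fun z => (q.map (algebraMap ℝ ℂ)).eval z *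
      exp (-(γ : ℂ) * z ^ 2 + (β : ℂ) * z) * P z := by
    funext z
    rw [hφ, hfP, hq]
    simp [eval_map_algebraMap]
    ring
  have hexp : HasLogDerivExpansion φ := by
    rw [hform]
    exact ((hasLogDerivExpansion_eval (by rwa [Ne, Polynomial.map_eq_zero])).mul
      ⟨_, _, _, logDerivExpansion_exp β hγ⟩).mul ⟨_, _, _, hPexp⟩
  have hconj : ∀ z, φ (conj z) = conj (φ z) := by
    have h1 : ∀ z, P (conj z) = conj (P z) := by
      intro z
      have h2 := (hP z).map (starRingEnd ℂ) continuous_conj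
      refine (hP (conj z)).unique ?_
      convert h2 using 2 with j
      simp [← exp_conj]
    intro z
    rw [hφ, hφ, hfP, hfP, h1, Polynomial.aeval_conj]
    simp [← exp_conj]
  have hfin : {z | φ z = 0 ∧ z.im ≠ 0}.Finite := by
    refine (finite_setOfPred_isRoot (p := q.map (algebraMap ℝ ℂ))
      (by rwa [Ne, Polynomial.map_eq_zero])).subset ?_
    rintro z ⟨hz, him⟩
    rw [hform, mul_eq_zero, mul_eq_zero] at hz
    rcases hz with (hz | hz) | hz
    · exact hz
    · exact absurd hz (exp_ne_zero _)
    · obtain ⟨j, rfl⟩ := (hPexp.zero_iff z).1 hz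
      simp at him
  obtain ⟨ι, ζ, δ, h⟩ := hexp
  refine ⟨ι, ζ, δ, ⟨h, ?_, hconj, hfin, ?_⟩⟩
  · by_contra! h0
    exact hne ⟨0, 0, fun z => by simp [h0]⟩
  · by_contra! hcon
    obtain ⟨h1, h2⟩ := hcon
    have h3 : δ = 0 := le_antisymm h2 h.gamma_nonneg
    subst h3
    exact hne (h.eq_const_mul_exp hconj)

/-! ### Twisting by an exponential -/

lemma LaguerrePolyaStar.expTwist {φ : ℂ → ℂ} (hφ : LaguerrePolyaStar φ) (σ : ℝ) :
    LaguerrePolyaStar (expTwist σ φ) := by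
  obtain ⟨p, f, hp, ⟨c, β, γ, d, ω, α, hγ, hα, hs, hf⟩, hφ⟩ := hφ
  refine ⟨p, fun z => exp (-(σ : ℂ) * z) * f z, hp,
    ⟨c, β - σ, γ, d, ω, α, hγ, hα, hs, fun z => ?_⟩, fun z => ?_⟩
  · obtain ⟨P, hP, h⟩ := hf z
    refine ⟨P, hP, ?_⟩
    have h1 : exp (-(γ : ℂ) * z ^ 2 + ((β - σ : ℝ) : ℂ) * z) =
        exp (-(σ : ℂ) * z) * exp (-(γ : ℂ) * z ^ 2 + (β : ℂ) * z) := by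
      rw [← exp_add]
      congr 1
      push_cast
      ring
    change exp (-(σ : ℂ) * z) * f z = _
    rw [h, h1]
    ring
  · rw [_root_.expTwist, hφ]
    ring

lemma expTwist_eq_zero_iff (σ : ℝ) (φ : ℂ → ℂ) (z : ℂ) : expTwist σ φ z = 0 ↔ φ z = 0 := by
  simp [expTwist, exp_ne_zero]

lemma RealLogDerivExpansion.twist {φ : ℂ → ℂ} {ι : Type} {ζ : ι → ℂ} {γ : ℝ}
    (h : RealLogDerivExpansion φ ζ γ) (σ : ℝ) :
    RealLogDerivExpansion (expTwist σ φ) (Sum.elim Empty.elim ζ) (0 + γ) := by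
  have h1 := (logDerivExpansion_exp (-σ) le_rfl).mul h.toLogDerivExpansion
  have h2 : (fun z => exp (-((0 : ℝ) : ℂ) * z ^ 2 + ((-σ : ℝ) : ℂ) * z) * φ z) =
      expTwist σ φ := by
    funext z
    simp [expTwist]
  rw [h2] at h1
  refine { h1 with exists_ne_zero := ?_, map_conj := ?_, finite_nonreal := ?_, nontrivial := ?_ }
  · simpa only [ne_eq, expTwist_eq_zero_iff] using h.exists_ne_zero
  · intro z
    simp [expTwist, h.map_conj, ← exp_conj]
  · simpa only [expTwist_eq_zero_iff] using h.finite_nonreal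
  · rcases h.nontrivial with ⟨⟨i⟩⟩ | hγ
    · exact Or.inl ⟨Sum.inr i⟩
    · exact Or.inr (by simpa using hγ)

/-! ### Real critical points of the logarithmic derivative and property A -/

lemma logDerivDeriv_eq_deriv_logDeriv (φ : ℂ → ℂ) : logDerivDeriv φ = deriv (logDeriv φ) := rfl

lemma exists_hasZeroAt_of_zeroCount_ne_zero {X : Set ℂ} {f : ℂ → ℂ} (h : zeroCount X f ≠ 0) :
    ∃ z ∈ X, HasZeroAt f z := by
  by_contra! hcon
  refine h (le_antisymm (iSup₂_le fun s hs => ?_) bot_le)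
  refine le_of_eq (Finset.sum_eq_zero fun z hz => ?_)
  have h1 := hcon z (hs hz)
  unfold HasZeroAt at h1
  unfold zeroMultiplicity
  cases hm : meromorphicOrderAt f z with
  | top => simp [hm] at h1
  | coe n =>
    rw [hm] at h1
    have h2 : n ≤ 0 := by
      rw [not_lt] at h1
      exact_mod_cast h1
    change ((n.toNat : ℕ) : ℕ∞) = 0
    rw [Int.toNat_of_nonpos h2]
    rfl

lemma finite_inter_zeros {f : ℂ → ℂ} (hf : Differentiable ℂ f) (hne : ∃ z, f z ≠ 0)
    {K : Set ℂ} (hK : IsCompact K) : {z ∈ K | f z = 0}.Finite := by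
  by_contra hinf
  obtain ⟨z, -, hz⟩ := Set.Infinite.exists_accPt_of_subset_isCompact hinf hK (Set.sep_subset _ _)
  rw [accPt_iff_frequently_nhdsNE] at hz
  obtain ⟨w, hw⟩ := hne
  exact hw (AnalyticOnNhd.eqOn_zero_of_preconnected_of_frequently_eq_zero
    (U := Set.univ) (fun z _ => hf.analyticAt z) isPreconnected_univ (Set.mem_univ z)
    (hz.mono fun y hy => hy.2) (Set.mem_univ w))

namespace RealLogDerivExpansion

variable {φ : ℂ → ℂ} {ι : Type} {ζ : ι → ℂ} {γ : ℝ}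

/-- The slope at `z` is exactly `-(2γ + sumInvProd ζ [z] w)`, so continuity of the sum replaces
termwise differentiation. -/
lemma hasDerivAt_logDeriv (h : RealLogDerivExpansion φ ζ γ) {z : ℂ} (hz : φ z ≠ 0) :
    HasDerivAt (logDeriv φ) (-(2 * γ + ∑' i, ((ζ i - z)⁻¹) ^ 2)) z := by
  have h1 := h.continuousAt_sumInvProd hz (T := [z]) (by simpa using hz) (by simp)
  have h2 : sumInvProd ζ [z] z = ∑' i, ((ζ i - z)⁻¹) ^ 2 := by simp [sumInvProd, sq]
  rw [hasDerivAt_iff_tendsto_slope, ← h2]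
  refine Filter.Tendsto.congr' ?_ ((h1.tendsto.mono_left nhdsWithin_le_nhds).const_add
    (2 * (γ : ℂ))).neg
  filter_upwards [(h.differentiable.continuous.continuousAt.eventually_ne hz).filter_mono
    nhdsWithin_le_nhds, eventually_mem_nhdsWithin] with w hw hwz
  have h3 : w - z ≠ 0 := sub_ne_zero.2 hwz
  rw [slope_def_field, h.logDeriv_sub w z hw hz]
  simp only [sumInvProd, List.map_cons, List.map_nil, List.prod_cons, List.prod_nil, mul_one]
  field_simp

lemma meromorphicOrderAt_logDeriv (h : RealLogDerivExpansion φ ζ γ) {z : ℂ} (hz : φ z = 0) :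
    meromorphicOrderAt (logDeriv φ) z = -1 := by
  have ha := h.differentiable.analyticAt z
  refine meromorphicOrderAt_logDeriv_eq_neg_one ha.meromorphicAt (fun h0 => ?_) (fun h0 => ?_)
  · rw [ha.meromorphicOrderAt_eq] at h0
    have h1 := ha.analyticOrderAt_ne_zero.2 hz
    cases hn : analyticOrderAt φ z with
    | top => exact h.analyticOrderAt_ne_top z hn
    | coe n =>
      rw [hn] at h0 h1
      have h2 : ((n : ℤ) : WithTop ℤ) = 0 := h0
      have h3 : (n : ℤ) = 0 := by exact_mod_cast h2
      simp at h3
      simp [h3] at h1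
  · rw [ha.meromorphicOrderAt_eq] at h0
    cases hn : analyticOrderAt φ z with
    | top => exact h.analyticOrderAt_ne_top z hn
    | coe n =>
      rw [hn] at h0
      exact WithTop.coe_ne_top h0

lemma not_differentiableAt_logDeriv (h : RealLogDerivExpansion φ ζ γ) {z : ℂ} (hz : φ z = 0) :
    ¬ DifferentiableAt ℂ (logDeriv φ) z := by
  intro hd
  have h1 := h.meromorphicOrderAt_logDeriv hz
  have h2 := tendsto_cobounded_of_meromorphicOrderAt_neg (f := logDeriv φ) (x := z)
    (by rw [h1]; decide)
  exact (Filter.Tendsto.not_tendsto (hd.continuousAt.tendsto.mono_left nhdsWithin_le_nhds)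
    (Metric.disjoint_nhds_cobounded _)) h2

/-- At a zero of `φ` the logarithmic derivative has a simple pole, so its derivative has order -2
there and no zero in the meromorphic sense. -/
lemma of_hasZeroAt_logDerivDeriv (h : RealLogDerivExpansion φ ζ γ) {z : ℂ}
    (hz : HasZeroAt (logDerivDeriv φ) z) : φ z ≠ 0 ∧ logDerivDeriv φ z = 0 := by
  rw [logDerivDeriv_eq_deriv_logDeriv] at hz ⊢
  unfold HasZeroAt at hz
  have hz0 : φ z ≠ 0 := by
    intro h0
    have h1 : meromorphicOrderAt (logDeriv φ) z = ((-1 : ℤ) : WithTop ℤ) :=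
      h.meromorphicOrderAt_logDeriv h0
    rw [meromorphicOrderAt_deriv_eq_sub_one (by simp) h1] at hz
    exact absurd hz (by decide)
  refine ⟨hz0, ?_⟩
  have ha : AnalyticAt ℂ (deriv (logDeriv φ)) z :=
    ((h.differentiable.analyticAt z).deriv.div (h.differentiable.analyticAt z) hz0).deriv
  exact tendsto_nhds_unique (ha.continuousAt.tendsto.mono_left nhdsWithin_le_nhds)
    (tendsto_zero_of_meromorphicOrderAt_pos hz)

lemma ofReal_re_logDeriv (h : RealLogDerivExpansion φ ζ γ) (x : ℝ) :
    (((logDeriv φ x).re : ℝ) : ℂ) = logDeriv φ x := by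
  refine conj_eq_iff_re.1 ?_
  rw [logDeriv_apply, map_div₀, ← deriv_conj_of_map_conj h.map_conj, ← h.map_conj, conj_ofReal]

lemma ofReal_re_apply (h : RealLogDerivExpansion φ ζ γ) (x : ℝ) :
    (((φ x).re : ℝ) : ℂ) = φ x := by
  refine conj_eq_iff_re.1 ?_
  rw [← h.map_conj, conj_ofReal]

lemma ofReal_re_deriv (h : RealLogDerivExpansion φ ζ γ) (x : ℝ) :
    (((deriv φ x).re : ℝ) : ℂ) = deriv φ x := by
  refine conj_eq_iff_re.1 ?_
  rw [← deriv_conj_of_map_conj h.map_conj, conj_ofReal]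

/-- Once `|x|` exceeds `|Re ζ| + |Im ζ|` for every nonreal zero, `|Im ζ| < |Re ζ - x|` for all
zeros, so each `(ζ - x)⁻²` has positive real part and the derivative is negative. -/
lemma exists_forall_abs_le (h : RealLogDerivExpansion φ ζ γ) :
    ∃ X : ℝ, ∀ x : ℝ, φ x ≠ 0 → logDerivDeriv φ x = 0 → |x| ≤ X := by
  obtain ⟨X, hX⟩ := (h.finite_nonreal.image fun z => |z.re| + |z.im|).bddAbove
  refine ⟨X, fun x hx hQ => not_lt.1 fun hlt => ?_⟩
  have hpos : ∀ i, 0 < (((ζ i - x)⁻¹) ^ 2).re := by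
    intro i
    have h0 := h.zeros_ne hx i
    have h1 : (ζ i).im ^ 2 < ((ζ i).re - x) ^ 2 := by
      rw [sq_lt_sq]
      rcases eq_or_ne (ζ i).im 0 with him | him
      · rw [him, abs_zero, abs_pos]
        intro h2
        apply h0
        apply Complex.ext <;> simp [him, h2]
      · have h2 : |(ζ i).re| + |(ζ i).im| ≤ X :=
          hX ⟨ζ i, ⟨(h.zero_iff _).2 ⟨i, rfl⟩, him⟩, rfl⟩
        have h3 := abs_sub_abs_le_abs_sub x (ζ i).re
        rw [abs_sub_comm] at h3
        linarith
    have h2 : 0 < normSq ((ζ i - x) ^ 2) := normSq_pos.2 (pow_ne_zero _ h0)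
    rw [inv_pow, inv_re]
    refine div_pos ?_ h2
    simp [sq]
    nlinarith
  have hsum : Summable fun i => ((ζ i - x)⁻¹) ^ 2 := by
    have := h.summable_inv_mul_prod hx (T := [(x : ℂ)]) (by simpa using hx) (by simp)
    simpa [sq] using this
  have hre := hasSum_re hsum.hasSum
  have heq : 2 * γ + (∑' i, ((ζ i - x)⁻¹) ^ 2).re = 0 := by
    rw [logDerivDeriv_eq_deriv_logDeriv, (h.hasDerivAt_logDeriv hx).deriv, neg_eq_zero] at hQ
    simpa using congrArg re hQ
  rcases h.nontrivial with ⟨⟨i⟩⟩ | hγ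
  · have h1 := hre.summable.tsum_pos (fun i => (hpos i).le) i (hpos i)
    rw [hre.tsum_eq] at h1
    have := h.gamma_nonneg
    linarith
  · have h1 := hre.nonneg fun i => (hpos i).le
    linarith

/-- The logarithmic derivative has only finitely many real critical points. -/
lemma finite_real_critical (h : RealLogDerivExpansion φ ζ γ) :
    {x : ℝ | φ x ≠ 0 ∧ logDerivDeriv φ x = 0}.Finite := by
  obtain ⟨X, hX⟩ := h.exists_forall_abs_le
  -- The entire numerator of `Q`: its zeros in a closed ball are finite in number unless it vanishes
  -- identically, which would make every real point beyond `X` a zero of `φ`.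
  set w : ℂ → ℂ := fun z => deriv (deriv φ) z * φ z - deriv φ z * deriv φ z with hw
  have hd1 := h.differentiable
  have hd2 := h.differentiable_deriv
  have hd3 : Differentiable ℂ (deriv (deriv φ)) :=
    fun z => (hd2.analyticAt z).deriv.differentiableAt
  have hwd : Differentiable ℂ w := (hd3.mul hd1).sub (hd2.mul hd2)
  have hQ : ∀ z, φ z ≠ 0 → logDerivDeriv φ z = w z / φ z ^ 2 := fun z hz =>
    ((hd2 z).hasDerivAt.div (hd1 z).hasDerivAt hz).deriv
  have hex : ∃ z, w z ≠ 0 := by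
    by_contra! hw0
    have hzero : ∀ x : ℝ, X < |x| → φ x = 0 := by
      intro x hx
      by_contra hne
      have := hX x hne (by rw [hQ _ hne, hw0, zero_div])
      linarith
    obtain ⟨u, hu⟩ := h.exists_ne_zero
    refine hu (AnalyticOnNhd.eqOn_zero_of_preconnected_of_frequently_eq_zero
      (U := Set.univ) (fun z _ => hd1.analyticAt z) isPreconnected_univ
      (Set.mem_univ ((|X| + 1 : ℝ) : ℂ)) ?_ (Set.mem_univ u))
    have h1 : Filter.Tendsto (fun t : ℝ => ((t : ℝ) : ℂ)) (𝓝[>] (|X| + 1))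
        (𝓝[≠] ((|X| + 1 : ℝ) : ℂ)) := by
      refine tendsto_nhdsWithin_iff.2 ⟨(continuous_ofReal.tendsto _).mono_left
        nhdsWithin_le_nhds, ?_⟩
      filter_upwards [eventually_mem_nhdsWithin] with t ht
      exact fun h0 => (ne_of_gt (show |X| + 1 < t from ht)) (ofReal_injective h0)
    refine h1.frequently (Filter.Eventually.frequently ?_)
    filter_upwards [eventually_mem_nhdsWithin] with t ht
    refine hzero t ?_
    have h2 : |X| + 1 < t := ht
    have h3 := le_abs_self X
    have h4 := le_abs_self t
    linarith
  have hfin := finite_inter_zeros hwd hex (isCompact_closedBall (0 : ℂ) X)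
  refine Set.Finite.of_finite_image (f := fun x : ℝ => (x : ℂ)) (hfin.subset ?_)
    ofReal_injective.injOn
  rintro _ ⟨x, ⟨hx, hx0⟩, rfl⟩
  refine ⟨by simpa using hX x hx hx0, ?_⟩
  rw [hQ _ hx] at hx0
  exact (div_eq_zero_iff.1 hx0).resolve_right (pow_ne_zero _ hx)

lemma logDeriv_expTwist (h : RealLogDerivExpansion φ ζ γ) (σ : ℝ) {z : ℂ} (hz : φ z ≠ 0) :
    logDeriv (expTwist σ φ) z = -σ + logDeriv φ z := by
  have h1 : HasDerivAt (fun z : ℂ => exp (-(σ : ℂ) * z)) (exp (-(σ : ℂ) * z) * -σ) z := by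
    simpa using ((hasDerivAt_id z).const_mul (-(σ : ℂ))).cexp
  have h2 : logDeriv (fun z : ℂ => exp (-(σ : ℂ) * z)) z = -σ := by
    rw [logDeriv_apply, h1.deriv, mul_div_cancel_left₀ _ (exp_ne_zero _)]
  rw [← h2]
  exact logDeriv_mul z (exp_ne_zero _) hz h1.differentiableAt h.differentiable.differentiableAt

lemma logDerivDeriv_expTwist (h : RealLogDerivExpansion φ ζ γ) (σ : ℝ) :
    logDerivDeriv (expTwist σ φ) = logDerivDeriv φ := by
  funext z
  simp only [logDerivDeriv_eq_deriv_logDeriv]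
  by_cases hz : φ z = 0
  · rw [deriv_zero_of_not_differentiableAt (h.not_differentiableAt_logDeriv hz),
      deriv_zero_of_not_differentiableAt ((h.twist σ).not_differentiableAt_logDeriv
        ((expTwist_eq_zero_iff σ φ z).2 hz))]
  · have h1 : logDeriv (expTwist σ φ) =ᶠ[𝓝 z] fun w => -(σ : ℂ) + logDeriv φ w := by
      filter_upwards [h.differentiable.continuous.continuousAt.eventually_ne hz] with w hw
      exact h.logDeriv_expTwist σ hw
    rw [h1.deriv_eq, deriv_const_add]

lemma two_le_order_deriv (h : RealLogDerivExpansion φ ζ γ) {z : ℂ} (hz : φ z ≠ 0)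
    (h1 : logDeriv φ z = 0) (h2 : logDerivDeriv φ z = 0) :
    2 ≤ analyticOrderAt (deriv φ) z := by
  have hd := h.differentiable_deriv
  have h3 : deriv φ z = 0 := by
    rw [logDeriv_apply] at h1
    exact (div_eq_zero_iff.1 h1).resolve_right hz
  have h4 : logDerivDeriv φ z =
      (deriv (deriv φ) z * φ z - deriv φ z * deriv φ z) / φ z ^ 2 :=
    ((hd z).hasDerivAt.div (h.differentiable z).hasDerivAt hz).deriv
  rw [h4, h3, mul_zero, sub_zero, div_eq_zero_iff, or_iff_left (pow_ne_zero _ hz),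
    mul_eq_zero, or_iff_left hz] at h2
  have h5 := (natCast_le_analyticOrderAt_iff_iteratedDeriv_eq_zero (n := 2)
    (hd.analyticAt z)).2 fun i hi => by
      interval_cases i
      · simpa using h3
      · simpa [iteratedDeriv_one] using h2
  exact_mod_cast h5

/-- To the right of a real zero `a`, up to the next real zero of `φ'`, the logarithmic
derivative is positive. -/
lemma re_logDeriv_pos (h : RealLogDerivExpansion φ ζ γ) {a x : ℝ} (ha : φ a = 0) (hax : a < x)
    (hne : ∀ y : ℝ, a < y → y ≤ x → deriv φ y ≠ 0) : 0 < (logDeriv φ x).re := by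
  have hg : ∀ y : ℝ, HasDerivAt (fun t : ℝ => (φ t).re) ((deriv φ y).re) y := fun y =>
    (h.differentiable y).hasDerivAt.real_of_complex
  have hne' : ∀ y ∈ Set.Ioc a x, (deriv φ y).re ≠ 0 := by
    intro y hy h0
    apply hne y hy.1 hy.2
    rw [← h.ofReal_re_deriv, h0, ofReal_zero]
  -- By the mean value theorem `φ(x) = φ'(c)(x - a)`, and by Darboux's theorem `φ'` has the same
  -- sign at `c` and `x`.
  obtain ⟨c, hc, hc'⟩ := exists_hasDerivAt_eq_slope (fun t : ℝ => (φ t).re)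
    (fun t : ℝ => (deriv φ t).re) hax (fun y _ => (hg y).continuousAt.continuousWithinAt)
    (fun y _ => hg y)
  have hxa : 0 < x - a := sub_pos.2 hax
  simp only [ha, zero_re, sub_zero] at hc'
  rw [eq_div_iff hxa.ne'] at hc'
  have hval : (logDeriv φ x).re = (deriv φ x).re / (φ x).re := by
    rw [logDeriv_apply, ← h.ofReal_re_deriv, ← h.ofReal_re_apply, ← ofReal_div]
    simp
  have hcm : c ∈ Set.Ioc a x := ⟨hc.1, hc.2.le⟩
  have hxm : x ∈ Set.Ioc a x := ⟨hax, le_rfl⟩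
  rw [hval, ← hc']
  rcases hasDerivWithinAt_forall_lt_or_forall_gt_of_forall_ne (convex_Ioc a x)
    (fun y _ => (hg y).hasDerivWithinAt) hne' with hs | hs
  · exact div_pos_of_neg_of_neg (hs x hxm) (mul_neg_of_neg_of_pos (hs c hcm) hxa)
  · exact div_pos (hs x hxm) (mul_pos (hs c hcm) hxa)

/-- The right-hand interval always works: the logarithmic derivative is positive there, so it
contains no critical point. -/
lemma propertyA_of_forall_re_logDeriv_nonpos (h : RealLogDerivExpansion φ ζ γ)
    (hC : ∀ x : ℝ, φ x ≠ 0 → logDerivDeriv φ x = 0 → (logDeriv φ x).re ≤ 0) :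
    PropertyA φ := by
  intro a ha b₁ b₂ hb₁ hb₂ _ _ hne
  refine Or.inr fun x hax hxb hQ => ?_
  obtain ⟨hx, hx0⟩ := h.of_hasZeroAt_logDerivDeriv hQ
  refine not_lt.2 (hC x hx hx0) (h.re_logDeriv_pos ha hax fun y hay hyx => ?_)
  refine hne y (hb₁.trans (by exact_mod_cast hay)) (lt_of_le_of_lt (by exact_mod_cast hyx) hxb)
    hay.ne'

lemma exists_maximal_critical_value (h : RealLogDerivExpansion φ ζ γ) :
    ∃ σ : ℝ, (∀ x : ℝ, φ x ≠ 0 → logDerivDeriv φ x = 0 → (logDeriv φ x).re ≤ σ) ∧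
      ∀ x : ℝ, φ x ≠ 0 → logDerivDeriv φ x = 0 →
        ∃ y : ℝ, φ y ≠ 0 ∧ logDerivDeriv φ y = 0 ∧ (logDeriv φ y).re = σ := by
  rcases Set.eq_empty_or_nonempty {x : ℝ | φ x ≠ 0 ∧ logDerivDeriv φ x = 0} with he | hne
  · have : ∀ x : ℝ, φ x ≠ 0 → logDerivDeriv φ x ≠ 0 := fun x h1 h2 =>
      Set.eq_empty_iff_forall_notMem.1 he x ⟨h1, h2⟩
    -- Without real critical points any `σ` would do.
    exact ⟨0, fun x h1 h2 => absurd h2 (this x h1), fun x h1 h2 => absurd h2 (this x h1)⟩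
  · obtain ⟨y, hy, hmax⟩ := Set.exists_max_image _ (fun x : ℝ => (logDeriv φ x).re)
      h.finite_real_critical hne
    exact ⟨(logDeriv φ y).re, fun x h1 h2 => hmax x ⟨h1, h2⟩,
      fun x h1 h2 => ⟨y, hy.1, hy.2, rfl⟩⟩

end RealLogDerivExpansion

/-! ### The theorem -/

lemma zeroMultiplicity_expTwist (φ : ℂ → ℂ) (σ : ℝ) (z : ℂ) :
    zeroMultiplicity (expTwist σ φ) z = zeroMultiplicity φ z := by
  unfold zeroMultiplicity
  have h1 : AnalyticAt ℂ (fun z : ℂ => exp (-(σ : ℂ) * z)) z := by fun_prop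
  have h2 : expTwist σ φ = (fun z : ℂ => exp (-(σ : ℂ) * z)) * φ := rfl
  rw [h2, meromorphicOrderAt_mul_of_ne_zero h1 (exp_ne_zero _)]

theorem mainTheorem3 (φ : ℂ → ℂ) (hφ : LaguerrePolyaStar φ)
    (hne : ¬ ∃ C β : ℝ, ∀ z : ℂ, φ z = (C : ℂ) * Complex.exp ((β : ℂ) * z)) :
    ∃ σ : ℝ,
      LaguerrePolyaStar (expTwist σ φ) ∧
      PropertyA (expTwist σ φ) ∧
      (∀ z : ℂ, expTwist σ φ z = 0 ↔ φ z = 0) ∧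
      (∀ z : ℂ, zeroMultiplicity (expTwist σ φ) z = zeroMultiplicity φ z) ∧
      logDerivDeriv (expTwist σ φ) = logDerivDeriv φ ∧
      (realZeroCount (logDerivDeriv φ) ≠ 0 →
        nonrealZeroCount (deriv (expTwist σ φ)) < nonrealZeroCount (expTwist σ φ)) := by
  obtain ⟨ι, ζ, γ, h⟩ := hφ.exists_realLogDerivExpansion hne
  obtain ⟨σ, hle, hattained⟩ := h.exists_maximal_critical_value
  have hψ := h.twist σ
  have hQ := h.logDerivDeriv_expTwist σ
  refine ⟨σ, hφ.expTwist σ, ?_, expTwist_eq_zero_iff σ φ,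
    zeroMultiplicity_expTwist φ σ, hQ, fun hreal => ?_⟩
  · refine hψ.propertyA_of_forall_re_logDeriv_nonpos fun x hx hx0 => ?_
    rw [Ne, expTwist_eq_zero_iff] at hx
    rw [hQ] at hx0
    have := hle x hx hx0
    rw [h.logDeriv_expTwist σ hx]
    simpa using this
  · obtain ⟨z, hz, hzero⟩ := exists_hasZeroAt_of_zeroCount_ne_zero hreal
    obtain ⟨h1, h2⟩ := h.of_hasZeroAt_logDerivDeriv hzero
    have hzr : ((z.re : ℝ) : ℂ) = z := conj_eq_iff_re.1 (conj_eq_iff_im.2 hz)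
    rw [← hzr] at h1 h2
    obtain ⟨x, hx, hx0, hxσ⟩ := hattained z.re h1 h2
    have hx' : expTwist σ φ x ≠ 0 := by rwa [Ne, expTwist_eq_zero_iff]
    -- At a point where the maximal critical value is attained, the twisted logarithmic derivative
    -- and its derivative both vanish.
    refine hψ.nonrealZeroCount_deriv_lt hx' (hψ.two_le_order_deriv hx' ?_ ?_)
    · rw [h.logDeriv_expTwist σ hx, ← h.ofReal_re_logDeriv, hxσ]
      ring
    · rw [hQ]
      exact hx0
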